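/- Let $\alpha,\beta,\kappa\in\mathbb R$, let $\theta\in[0,2\pi)$ denote spatial frequency, and put $\sigma_\theta=\alpha(1+2\kappa\cos\theta)$. Consider the spatially invariant plant $$x^1_{k,t+1}=\beta x^1_{k,t}+x^2_{k,t},\qquad x^2_{k,t+1}=\alpha\big(x^2_{k,t}+\kappa(x^2_{k-1,t}+x^2_{k+1,t})\big)+w^u_{k,t}+u_{k,t},$$ $$\zeta_{k,t}=(x^1_{k,t},x^2_{k,t},u_{k,t}),\qquad y_{k,t}=x^1_{k,t}+w^y_{k,t}\qquad(k\in\mathbb Z),$$ with spatially invariant controllers $u=Ky$, given by a rational function $K_\theta(z)$ for each $\theta$. For a well-posed loop let $\Gamma,\Lambda,\Psi,\Omega$ be the closed-loop maps defined by $\begin{bmatrix}y\\u+w^u\end{bmatrix}=\begin{bmatrix}\Gamma&\Lambda\\\Psi&\Omega\end{bmatrix}\begin{bmatrix}w^y\\w^u\end{bmatrix}$, and let $\mathcal F(P,K)$ be the closed-loop map from $w=(w^y,w^u)$ to $\zeta$. $\mathcal{RH}_\infty$ is the set of proper rational functions of $z$ with all poles in the open unit disk. $K$ is internally stabilizing if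 for every $\theta$ the loop is well posed and $\Gamma_\theta,\Lambda_\theta,\Psi_\theta,\Omega_\theta\in\mathcal{RH}_\infty$. A scalar map $G$ has extent $E$ ($\mathrm{ext}(G)\le E$) if $G_\theta=\sum_{|k|\le E}g_ke^{-ik\theta}$ with real rational $g_k$. The squared $\mathcal H_2$ norm of $G$ is $\frac1{4\pi^2}\int_0^{2\pi}\!\int_{|z|=1}\mathrm{trace}(G_{\theta,z}^\dagger G_{\theta,z})\,|dz|\,d\theta$, and that of a finite column $v$ of transfer functions in the spatial index domain is $\frac1{2\pi}\int_{|z|=1}\sum_k|v_k(z)|^2\,|dz|$. Consider the problem $$(\ast)\qquad \inf_K\ \|\mathcal F(P,K)\|_2\quad\text{s.t. } K\text{ internally stabilizing and } \mathrm{ext}(\Gamma),\mathrm{ext}(\Lambda),\mathrm{ext}(\Psi),\mathrm{ext}(\Omega)<\infty.$$ For $E\in\mathbb N$ and a real rational column $f=(f_k)_{|k|\le E}\in\mathcal{RH}_\infty^{(2E+1)\times1}$ put $f_\theta=\sum_{|k|\le E}f_ke^{-ik\theta}$ and $$\lambda_\theta(f)=z^{-2}+z^{-3}(\sigma_\theta+\beta)+z^{-4}f_\theta,\quad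 \gamma_\theta(f)=(z-\beta)(z-\sigma_\theta)\lambda_\theta(f),\quad \psi_\theta(f)=(z-\beta)^2(z-\sigma_\theta)^2\lambda_\theta(f)-(z-\beta)(z-\sigma_\theta),$$ and $K(f)=\psi(f)\gamma(f)^{-1}$. Let $V^{\rm IO},h^{\rm IO}$ be the matrix and column of transfer functions such that $V^{\rm IO}f+h^{\rm IO}$ stacks the index-domain coefficients of $\gamma(f)-1$ (indices $|k|\le E+2$), $\lambda(f)$ ($|k|\le E+1$), $(z-\beta)(\gamma(f)-1)$ ($|k|\le E+2$), $(z-\beta)\lambda(f)$ ($|k|\le E+1$), $\psi(f)$ ($|k|\le E+3$) and $\gamma(f)-1$ ($|k|\le E+2$); explicitly $V^{\rm IO}=WS$ and $h^{\rm IO}=Wg+h$, where $S=z^{-4}[0;I_{2E+1};0]$, $g$ is the column of $z^{-2}+z^{-3}(\sigma+\beta)$, $W$ stacks the banded Toeplitz matrices of multiplication by $(z-\beta)(z-\sigma)$, $1$, $(z-\beta)^2(z-\sigma)$, $z-\beta$, $(z-\beta)^2(z-\sigma)^2$, $(z-\beta)(z-\sigma)$, and $h$ stacks the columns of $-1$,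 $0$, $-(z-\beta)$, $0$, $-(z-\beta)(z-\sigma)$, $-1$. Theorem. 1. For every internally stabilizing $K$, $$\mathcal F(P,K)=\begin{bmatrix}\Gamma-1&\Lambda\\(z-\beta)(\Gamma-1)&(z-\beta)\Lambda\\\Psi&\Omega-1\end{bmatrix};$$ in particular $x^2=(z-\beta)\big((\Gamma-1)w^y+\Lambda w^u\big)$. 2. For every $E\in\mathbb N$ let $\mathcal K_E$ be the set of controllers feasible for $(\ast)$ whose parameter $z^4\Lambda_\theta-z^2-z(\sigma_\theta+\beta)$ has extent $E$. Then $f\mapsto K(f)$ is a bijection from $\mathcal{RH}_\infty^{(2E+1)\times1}$ (that is, $2E+1$ scalar decision variables) onto $\mathcal K_E$. For every such $f$ the controller $K(f)$ has $\Lambda=\lambda(f)$, $\mathrm{ext}(\Gamma),\mathrm{ext}(\Omega)\le\max\{E+1,2\}$, $\mathrm{ext}(\Lambda)\le\max\{E,1\}$, $\mathrm{ext}(\Psi)\le\max\{E+2,3\}$, and $\|\mathcal F(P,K(f))\|_2^2=\|V^{\rm IO}f+h^{\rm IO}\|_2^2<\infty$. If $E\ge1$, then $\mathcal K_E$ is exactly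 the set of internally stabilizing controllers that satisfy these four extent bounds. Consequently $$\Big(\inf_{K\in\mathcal K_E}\|\mathcal F(P,K)\|_2\Big)^2=\inf_{f\in\mathcal{RH}_\infty^{(2E+1)\times1}}\|V^{\rm IO}f+h^{\rm IO}\|_2^2,$$ $K(f)$ is optimal for the left-hand problem if and only if $f$ is optimal for the right-hand one, and the right-hand objective is convex in $f$. 3. The feasible set of $(\ast)$ is $\bigcup_{E\in\mathbb N}\{K(f): f\in\mathcal{RH}_\infty^{(2E+1)\times1}\}$, and the square of the value of $(\ast)$ is $\inf_{E\in\mathbb N}\inf_{f\in\mathcal{RH}_\infty^{(2E+1)\times 1}}\|V^{\rm IO}f+h^{\rm IO}\|_2^2$. -/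

import Mathlib

open MeasureTheory

namespace IOSynthesis

noncomputable section

/-! ### Transfer functions -/

/-- A rational transfer function in `z` (the variable `RatFunc.X`) with coefficients in a field `F`
(used for `F = ℝ` and `F = ℂ`) belongs to `RH∞`: it is causal (proper), and stable, i.e. all its
poles lie in the open unit disk. `num` and `denom` are coprime, so the poles are the complex roots
of `denom`. -/
def IsRHInf {F : Type*} [Field F] [Algebra F ℂ] (g : RatFunc F) : Prop :=
  g.num.natDegree ≤ g.denom.natDegree ∧
    ∀ p : ℂ, Polynomial.aeval p g.denom = 0 → ‖p‖ < 1

/-- A real rational function regarded as a complex one. -/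
def complexify : RatFunc ℝ →+* RatFunc ℂ :=
  RatFunc.mapRingHom (Polynomial.mapRingHom (algebraMap ℝ ℂ)) fun p hp => by
    rw [Submonoid.mem_comap, mem_nonZeroDivisors_iff_ne_zero]
    rw [mem_nonZeroDivisors_iff_ne_zero] at hp
    exact (Polynomial.map_ne_zero_iff (algebraMap ℝ ℂ).injective).2 hp

/-- Spatial frequencies `θ ∈ [0, 2π)`. -/
abbrev Freq : Type := Set.Ico (0 : ℝ) (2 * Real.pi)

/-- The spatial indices `-E, …, E`. -/
abbrev Site (E : ℕ) : Type := Finset.Icc (-(E : ℤ)) (E : ℤ)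

/-- Spatial Fourier transform `θ ↦ ∑_{|k| ≤ E} g_k e^{-ikθ}` of the scalar index-domain map whose
`k`-th component is `g_k` for `|k| ≤ E` and `0` for `|k| > E`. -/
def spatialTransform {E : ℕ} (g : Site E → RatFunc ℝ) (θ : Freq) : RatFunc ℂ :=
  ∑ k : Site E,
    RatFunc.C (Complex.exp (-(Complex.I * ((k : ℤ) : ℂ) * ((θ : ℝ) : ℂ)))) * complexify (g k)

/-- A scalar spatially invariant map, given in the spatial frequency domain, has extent (at most)
`E`: its index-domain kernel `g_k` vanishes for `|k| > E`, i.e. the Toeplitz operator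
`(g_{i-j})_{i,j}` is structured with respect to the `E`-nearest neighbors graph. -/
def HasExtent (G : Freq → RatFunc ℂ) (E : ℕ) : Prop :=
  ∃ g : Site E → RatFunc ℝ, ∀ θ, G θ = spatialTransform g θ

/-! ### The plant

In the spatial index domain:
`x¹_{k,t+1} = β x¹_{k,t} + x²_{k,t}`,
`x²_{k,t+1} = α (x²_{k,t} + κ (x²_{k-1,t} + x²_{k+1,t})) + wᵘ_{k,t} + u_{k,t}`,
`ζ_{k,t} = (x¹_{k,t}, x²_{k,t}, u_{k,t})`, `y_{k,t} = x¹_{k,t} + wʸ_{k,t}`.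
Below it is written at a spatial frequency `θ`, with disturbance `w = (wʸ, wᵘ)`. -/

/-- `σ_θ = α (1 + 2 κ cos θ)`. -/
def sigma (α κ : ℝ) (θ : Freq) : ℝ := α * (1 + 2 * κ * Real.cos θ)

def matA (α β κ : ℝ) (θ : Freq) : Matrix (Fin 2) (Fin 2) ℂ := !![(β : ℂ), 1; 0, (sigma α κ θ : ℂ)]

def matB1 : Matrix (Fin 2) (Fin 2) ℂ := !![0, 0; 0, 1]

def matB2 : Matrix (Fin 2) (Fin 1) ℂ := !![0; 1]

def matC1 : Matrix (Fin 3) (Fin 2) ℂ := !![1, 0; 0, 1; 0, 0]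

def matD12 : Matrix (Fin 3) (Fin 1) ℂ := !![0; 0; 1]

def matC2 : Matrix (Fin 1) (Fin 2) ℂ := !![1, 0]

def matD21 : Matrix (Fin 1) (Fin 2) ℂ := !![1, 0]

/-- `(zI - A_θ)⁻¹`. -/
def plantResolvent (α β κ : ℝ) (θ : Freq) : Matrix (Fin 2) (Fin 2) (RatFunc ℂ) :=
  ((RatFunc.X : RatFunc ℂ) • (1 : Matrix (Fin 2) (Fin 2) (RatFunc ℂ))
    - (matA α β κ θ).map RatFunc.C)⁻¹

/-- `P^{ζw} = C¹ (zI - A)⁻¹ B¹`. -/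
def plantZW (α β κ : ℝ) (θ : Freq) : Matrix (Fin 3) (Fin 2) (RatFunc ℂ) :=
  matC1.map RatFunc.C * plantResolvent α β κ θ * matB1.map RatFunc.C

/-- `P^{ζu} = C¹ (zI - A)⁻¹ B² + D¹²`. -/
def plantZU (α β κ : ℝ) (θ : Freq) : Matrix (Fin 3) (Fin 1) (RatFunc ℂ) :=
  matC1.map RatFunc.C * plantResolvent α β κ θ * matB2.map RatFunc.C + matD12.map RatFunc.C

/-- `P^{yw} = C² (zI - A)⁻¹ B¹ + D²¹`. -/
def plantYW (α β κ : ℝ) (θ : Freq) : Matrix (Fin 1) (Fin 2) (RatFunc ℂ) :=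
  matC2.map RatFunc.C * plantResolvent α β κ θ * matB1.map RatFunc.C + matD21.map RatFunc.C

/-- `P^{yu} = C² (zI - A)⁻¹ B²`, a scalar. -/
def plantYU (α β κ : ℝ) (θ : Freq) : RatFunc ℂ :=
  (matC2.map RatFunc.C * plantResolvent α β κ θ * matB2.map RatFunc.C) 0 0

/-! ### Closed loop -/

/-- A spatially invariant controller `u = K y`: one rational function for every frequency. -/
abbrev Controller : Type := Freq → RatFunc ℂ

/-- The loop equations `y - P^{yu} v = wʸ`, `v - K y = wᵘ` in the unknowns `y` and `v = u + wᵘ`. -/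
def loopMatrix (α β κ : ℝ) (K : Controller) (θ : Freq) : Matrix (Fin 2) (Fin 2) (RatFunc ℂ) :=
  !![1, -plantYU α β κ θ; -K θ, 1]

/-- The closed-loop map `[Γ, Λ; Ψ, Ω]` from `(wʸ, wᵘ)` to `(y, u + wᵘ)`. -/
def ioMaps (α β κ : ℝ) (K : Controller) (θ : Freq) : Matrix (Fin 2) (Fin 2) (RatFunc ℂ) :=
  (loopMatrix α β κ K θ)⁻¹

def Gam (α β κ : ℝ) (K : Controller) (θ : Freq) : RatFunc ℂ := ioMaps α β κ K θ 0 0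

def Lam (α β κ : ℝ) (K : Controller) (θ : Freq) : RatFunc ℂ := ioMaps α β κ K θ 0 1

def Psi (α β κ : ℝ) (K : Controller) (θ : Freq) : RatFunc ℂ := ioMaps α β κ K θ 1 0

def Ome (α β κ : ℝ) (K : Controller) (θ : Freq) : RatFunc ℂ := ioMaps α β κ K θ 1 1

/-- `C_stab`: at every frequency the loop is well posed and all four closed-loop maps are in
`RH∞`. -/
def InternallyStabilizing (α β κ : ℝ) (K : Controller) : Prop :=
  ∀ θ, (loopMatrix α β κ K θ).det ≠ 0 ∧
    IsRHInf (Gam α β κ K θ) ∧ IsRHInf (Lam α β κ K θ) ∧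
    IsRHInf (Psi α β κ K θ) ∧ IsRHInf (Ome α β κ K θ)

/-- `F(P, K) = P^{ζw} + P^{ζu} K (1 - P^{yu} K)⁻¹ P^{yw}`, the closed-loop map from
`w = (wʸ, wᵘ)` to `ζ = (x¹, x², u)`. -/
def closedLoop (α β κ : ℝ) (K : Controller) (θ : Freq) : Matrix (Fin 3) (Fin 2) (RatFunc ℂ) :=
  plantZW α β κ θ +
    (K θ * (1 - plantYU α β κ θ * K θ)⁻¹) • (plantZU α β κ θ * plantYW α β κ θ)

/-- The squared `H₂` norm
`(1 / 4π²) ∫_θ ∫_{|z| = 1} trace (G_{θ,z}† G_{θ,z})` of a map in the spatio-temporal frequency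
domain, with `z = e^{iφ}` and Lebesgue measure in `θ` and `φ`. -/
def h2NormSqFreq {m n : Type*} [Fintype m] [Fintype n] (G : Freq → Matrix m n (RatFunc ℂ)) :
    ENNReal :=
  ENNReal.ofReal (1 / (4 * Real.pi ^ 2)) *
    ∫⁻ θ : Freq, (∫⁻ φ in Set.Ico (0 : ℝ) (2 * Real.pi),
      ∑ i, ∑ j, ‖RatFunc.eval (RingHom.id ℂ) (Complex.exp (Complex.I * φ)) (G θ i j)‖ₑ ^ 2)
      ∂(Measure.comap Subtype.val volume)

/-- The squared `H₂` norm `(1 / 2π) ∫_{|z| = 1} ∑_k |v_k(z)|²` of a finite vector of transfer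
functions in the spatial index domain. -/
def h2NormSqIndex {m : Type*} [Fintype m] (v : m → RatFunc ℝ) : ENNReal :=
  ENNReal.ofReal (1 / (2 * Real.pi)) *
    ∫⁻ φ in Set.Ico (0 : ℝ) (2 * Real.pi),
      ∑ k, ‖RatFunc.eval (algebraMap ℝ ℂ) (Complex.exp (Complex.I * φ)) (v k)‖ₑ ^ 2

/-- The cost `‖F(P, K)‖₂` of the optimal control problem. -/
def cost (α β κ : ℝ) (K : Controller) : ENNReal :=
  h2NormSqFreq (closedLoop α β κ K) ^ (1 / 2 : ℝ)

/-! ### Feasible sets -/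

/-- Internally stabilizing controllers for which `Γ, Λ, Ψ, Ω` have finite extent. -/
def feasible (α β κ : ℝ) : Set Controller :=
  {K | InternallyStabilizing α β κ K ∧
    (∃ E, HasExtent (Gam α β κ K) E) ∧ (∃ E, HasExtent (Lam α β κ K) E) ∧
    (∃ E, HasExtent (Psi α β κ K) E) ∧ (∃ E, HasExtent (Ome α β κ K) E)}

/-- Internally stabilizing controllers for which `Γ` and `Ω` have extent `max (E+1) 2`, `Λ` has
extent `max E 1` and `Ψ` has extent `max (E+2) 3`. -/
def feasibleBounded (α β κ : ℝ) (E : ℕ) : Set Controller :=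
  {K | InternallyStabilizing α β κ K ∧
    HasExtent (Gam α β κ K) (max (E + 1) 2) ∧ HasExtent (Lam α β κ K) (max E 1) ∧
    HasExtent (Psi α β κ K) (max (E + 2) 3) ∧ HasExtent (Ome α β κ K) (max (E + 1) 2)}

/-- The parameter `f_θ` of a controller, i.e. the solution of
`Λ_θ = z⁻² + z⁻³ (σ_θ + β) + z⁻⁴ f_θ`. -/
def parameter (α β κ : ℝ) (K : Controller) (θ : Freq) : RatFunc ℂ :=
  RatFunc.X ^ 4 * Lam α β κ K θ - RatFunc.X ^ 2
    - RatFunc.X * RatFunc.C ((sigma α κ θ + β : ℝ) : ℂ)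

/-! ### The unconstrained problem -/

/-- `RH∞^{(2E+1) × 1}`. -/
def RHInfVec (E : ℕ) : Set (Site E → RatFunc ℝ) := {f | ∀ k, IsRHInf (f k)}

/-- `λ_θ(f) = z⁻² + z⁻³ (σ_θ + β) + z⁻⁴ f_θ`. -/
def lamOf (α β κ : ℝ) {E : ℕ} (f : Site E → RatFunc ℝ) (θ : Freq) : RatFunc ℂ :=
  (RatFunc.X ^ 2)⁻¹ + (RatFunc.X ^ 3)⁻¹ * RatFunc.C ((sigma α κ θ + β : ℝ) : ℂ)
    + (RatFunc.X ^ 4)⁻¹ * spatialTransform f θ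

/-- `(z - β)(z - σ_θ)`. -/
def charPoly (α β κ : ℝ) (θ : Freq) : RatFunc ℂ :=
  (RatFunc.X - RatFunc.C (β : ℂ)) * (RatFunc.X - RatFunc.C (sigma α κ θ : ℂ))

/-- `γ_θ(f) = ω_θ(f) = (z - β)(z - σ_θ) λ_θ(f)`. -/
def gamOf (α β κ : ℝ) {E : ℕ} (f : Site E → RatFunc ℝ) (θ : Freq) : RatFunc ℂ :=
  charPoly α β κ θ * lamOf α β κ f θ

/-- `ψ_θ(f) = (z - β)² (z - σ_θ)² λ_θ(f) - (z - β)(z - σ_θ)`. -/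
def psiOf (α β κ : ℝ) {E : ℕ} (f : Site E → RatFunc ℝ) (θ : Freq) : RatFunc ℂ :=
  charPoly α β κ θ ^ 2 * lamOf α β κ f θ - charPoly α β κ θ

/-- The controller `K = Ψ(f) Γ(f)⁻¹`. -/
def controllerOf (α β κ : ℝ) {E : ℕ} (f : Site E → RatFunc ℝ) : Controller :=
  fun θ => psiOf α β κ f θ * (gamOf α β κ f θ)⁻¹

/-- `z - c` for a real constant `c`. -/
def zSub (c : ℝ) : RatFunc ℝ := RatFunc.X - RatFunc.C c

/-- The Toeplitz matrix `V^γ = V^ω` of multiplication by `(z - β)(z - σ)`. -/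
def matVGam (α β κ : ℝ) (E : ℕ) : Matrix (Site (E + 2)) (Site (E + 1)) (RatFunc ℝ) :=
  Matrix.of fun i j => zSub β *
    (if |(i : ℤ) - (j : ℤ)| = 0 then zSub α
    else if |(i : ℤ) - (j : ℤ)| = 1 then RatFunc.C (-(α * κ))
    else 0)

/-- The Toeplitz matrix `V^ψ` of multiplication by `(z - β)² (z - σ)²`. -/
def matVPsi (α β κ : ℝ) (E : ℕ) : Matrix (Site (E + 3)) (Site (E + 1)) (RatFunc ℝ) :=
  Matrix.of fun i j => zSub β ^ 2 *
    (if |(i : ℤ) - (j : ℤ)| = 0 then zSub α ^ 2 + RatFunc.C (2 * (α * κ) ^ 2)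
    else if |(i : ℤ) - (j : ℤ)| = 1 then RatFunc.C (-(2 * (α * κ))) * zSub α
    else if |(i : ℤ) - (j : ℤ)| = 2 then RatFunc.C ((α * κ) ^ 2)
    else 0)

/-- The column `-δ_k` of the constant terms of `γ - 1` and `ω - 1`. -/
def vecHGam (E : ℕ) : Site (E + 2) → RatFunc ℝ := fun k => if (k : ℤ) = 0 then -1 else 0

/-- The column `h^ψ` of `-(z - β)(z - σ)`. -/
def vecHPsi (α β κ : ℝ) (E : ℕ) : Site (E + 3) → RatFunc ℝ := fun k => zSub β *
  (if |(k : ℤ)| = 0 then -zSub α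
  else if |(k : ℤ)| = 1 then RatFunc.C (α * κ)
  else 0)

/-- `S = z⁻⁴ [0; I; 0]`. -/
def matS (E : ℕ) : Matrix (Site (E + 1)) (Site E) (RatFunc ℝ) :=
  Matrix.of fun i j => if (i : ℤ) = (j : ℤ) then (RatFunc.X ^ 4)⁻¹ else 0

/-- `g`, the column of `z⁻² + z⁻³ (σ + β)`. -/
def vecG (α β κ : ℝ) (E : ℕ) : Site (E + 1) → RatFunc ℝ := fun k => (RatFunc.X ^ 3)⁻¹ *
  (if |(k : ℤ)| = 0 then RatFunc.X + RatFunc.C (α + β)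
  else if |(k : ℤ)| = 1 then RatFunc.C (α * κ)
  else 0)

/-- Row labels of the stacked column
`γ - 1, λ, (z - β)(γ - 1), (z - β) λ, ψ, ω - 1`. -/
abbrev Rows (E : ℕ) : Type :=
  Site (E + 2) ⊕ Site (E + 1) ⊕ Site (E + 2) ⊕ Site (E + 1) ⊕ Site (E + 3) ⊕ Site (E + 2)

/-- The stacked linear parts, acting on the column of `λ`. -/
def matStack (α β κ : ℝ) (E : ℕ) : Matrix (Rows E) (Site (E + 1)) (RatFunc ℝ) :=
  Matrix.fromRows (matVGam α β κ E) <|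
  Matrix.fromRows 1 <|
  Matrix.fromRows (zSub β • matVGam α β κ E) <|
  Matrix.fromRows (zSub β • (1 : Matrix (Site (E + 1)) (Site (E + 1)) (RatFunc ℝ))) <|
  Matrix.fromRows (matVPsi α β κ E) (matVGam α β κ E)

/-- The stacked constant parts. -/
def vecStack (α β κ : ℝ) (E : ℕ) : Rows E → RatFunc ℝ :=
  Sum.elim (vecHGam E) <| Sum.elim 0 <| Sum.elim (zSub β • vecHGam E) <| Sum.elim 0 <|
    Sum.elim (vecHPsi α β κ E) (vecHGam E)

/-- `V^{IO}`. -/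
def matVIO (α β κ : ℝ) (E : ℕ) : Matrix (Rows E) (Site E) (RatFunc ℝ) :=
  matStack α β κ E * matS E

/-- `h^{IO}`. -/
def vecHIO (α β κ : ℝ) (E : ℕ) : Rows E → RatFunc ℝ :=
  (matStack α β κ E).mulVec (vecG α β κ E) + vecStack α β κ E

/-- The objective `‖V^{IO} f + h^{IO}‖₂²`. -/
def objective (α β κ : ℝ) (E : ℕ) (f : Site E → RatFunc ℝ) : ENNReal :=
  h2NormSqIndex ((matVIO α β κ E).mulVec f + vecHIO α β κ E)

end

end IOSynthesis

/-!
Inverting the loop matrix gives `Γ = Ω = (z - β)(z - σ) Λ` and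
`Ψ = (z - β)² (z - σ)² Λ - (z - β)(z - σ)`, so that `Λ` determines the controller. The factor
`(z - β)² (z - σ)²` has degree four: if `Ψ` is proper, then `Λ` agrees with `((z - β)(z - σ))⁻¹` up
to `O(z⁻⁴)` at infinity, which means `Λ = z⁻² + z⁻³ (σ + β) + z⁻⁴ f` with `f` proper; `f` is stable
because `Λ` is. Conversely every `f ∈ RH∞` gives four maps in `RH∞` and a well-posed loop, because
`Γ` tends to `1` at infinity.

In the spatial variable a map of extent `E` is a Laurent polynomial of degree at most `E` in
`e^{-iθ}`, and `(z - β)(z - σ)` is one of degree `1`; multiplying Laurent polynomials gives both the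
extent bounds and the banded Toeplitz matrices in `V^{IO}` and `h^{IO}`. Parseval's identity in `θ`
shows that the coefficients of a Laurent polynomial inherit the properties of its values, and that
the norm in the frequency domain is the norm of the stacked column in the index domain.
-/

namespace IOSynthesis

noncomputable section

section RationalFunctions

variable {F : Type*} [Field F]

open scoped Classical in
/-- The proper (causal) rational functions, i.e. those without a pole at infinity. -/
def properSubalgebra (F : Type*) [Field F] : Subalgebra F (RatFunc F) where
  __ := (RatFunc.inftyValuation F).integer
  algebraMap_mem' c := by
    rw [RatFunc.algebraMap_eq_C]
    by_cases hc : c = 0 <;> simp [Valuation.mem_integer_iff, hc]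

theorem mem_properSubalgebra {g : RatFunc F} :
    g ∈ properSubalgebra F ↔ g.intDegree ≤ 0 := by
  classical
  change RatFunc.inftyValuation F g ≤ 1 ↔ _
  by_cases hg : g = 0
  · simp [hg]
  · rw [RatFunc.inftyValuation_apply, RatFunc.inftyValuation_of_nonzero F hg,
      ← WithZero.exp_zero, WithZero.exp_le_exp]

theorem X_pow_notMem_properSubalgebra {n : ℕ} (hn : n ≠ 0) :
    (RatFunc.X : RatFunc F) ^ n ∉ properSubalgebra F := by
  rw [mem_properSubalgebra, ← RatFunc.algebraMap_X, ← map_pow, RatFunc.intDegree_polynomial]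
  simp [hn]

variable [Algebra F ℂ]

/-- The stable rational functions, i.e. those with all poles in the open unit disk. -/
def stableSubalgebra (F : Type*) [Field F] [Algebra F ℂ] : Subalgebra F (RatFunc F) where
  carrier := {g | ∀ p : ℂ, Polynomial.aeval p g.denom = 0 → ‖p‖ < 1}
  add_mem' {a b} ha hb p hp := by
    have h := zero_dvd_iff.1 (hp ▸ map_dvd (Polynomial.aeval p) (RatFunc.denom_add_dvd a b))
    rw [map_mul, mul_eq_zero] at h
    exact h.elim (ha p) (hb p)
  mul_mem' {a b} ha hb p hp := by
    have h := zero_dvd_iff.1 (hp ▸ map_dvd (Polynomial.aeval p) (RatFunc.denom_mul_dvd a b))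
    rw [map_mul, mul_eq_zero] at h
    exact h.elim (ha p) (hb p)
  algebraMap_mem' c p hp := by simp [RatFunc.algebraMap_eq_C] at hp

/-- The algebra `RH∞`. -/
def rhInf (F : Type*) [Field F] [Algebra F ℂ] : Subalgebra F (RatFunc F) :=
  properSubalgebra F ⊓ stableSubalgebra F

theorem mem_rhInf {g : RatFunc F} : g ∈ rhInf F ↔ IsRHInf g := by
  rw [rhInf, Algebra.mem_inf, mem_properSubalgebra, RatFunc.intDegree, sub_nonpos, Nat.cast_le]
  rfl

theorem rhInf_le_stableSubalgebra : rhInf F ≤ stableSubalgebra F := inf_le_right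

theorem X_mem_stableSubalgebra : RatFunc.X ∈ stableSubalgebra F := fun p hp => by simp at hp

theorem inv_X_mem_rhInf : (RatFunc.X : RatFunc F)⁻¹ ∈ rhInf F := by
  refine ⟨mem_properSubalgebra.2 (by simp), fun p hp => ?_⟩
  have hd := RatFunc.denom_inv_dvd (RatFunc.X_ne_zero (K := F))
  have hX := zero_dvd_iff.1 (hp ▸ map_dvd (Polynomial.aeval p) hd)
  have hp0 : p = 0 := by simpa using hX
  simp [hp0]

theorem C_mem_rhInf (c : F) : RatFunc.C c ∈ rhInf F :=
  RatFunc.algebraMap_eq_C (K := F) ▸ algebraMap_mem (rhInf F) c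

end RationalFunctions

section Evaluation

variable {F : Type} [Field F] [Algebra F ℂ]

theorem eval₂_denom_ne_zero {g : RatFunc F} (hg : g ∈ stableSubalgebra F) {z : ℂ}
    (hz : 1 ≤ ‖z‖) : g.denom.eval₂ (algebraMap F ℂ) z ≠ 0 := fun h => (hg z h).not_ge hz

/-- Evaluation at a point `z` with `1 ≤ ‖z‖`, as a homomorphism on the stable rational functions.
On all rational functions the junk value at the poles keeps `RatFunc.eval` from being additive. -/
def evalStable {z : ℂ} (hz : 1 ≤ ‖z‖) : stableSubalgebra F →ₐ[F] ℂ where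
  toFun g := RatFunc.eval (algebraMap F ℂ) z (g : RatFunc F)
  map_zero' := RatFunc.eval_zero _ _
  map_one' := RatFunc.eval_one _ _
  map_add' g h := RatFunc.eval_add _ _ (eval₂_denom_ne_zero g.2 hz) (eval₂_denom_ne_zero h.2 hz)
  map_mul' g h := RatFunc.eval_mul _ _ (eval₂_denom_ne_zero g.2 hz) (eval₂_denom_ne_zero h.2 hz)
  commutes' c := by
    rw [Subalgebra.coe_algebraMap, RatFunc.algebraMap_eq_C, RatFunc.eval_C]

theorem eval_sum_smul {ι : Type*} [Fintype ι] (c : ι → F) {g : ι → RatFunc F}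
    (hg : ∀ i, g i ∈ stableSubalgebra F) {z : ℂ} (hz : 1 ≤ ‖z‖) :
    RatFunc.eval (algebraMap F ℂ) z (∑ i, c i • g i) =
      ∑ i, c i • RatFunc.eval (algebraMap F ℂ) z (g i) := by
  lift g to ι → stableSubalgebra F using hg
  have h : ∑ i, c i • (g i : RatFunc F) = (∑ i, c i • g i : stableSubalgebra F) := by
    simp
  rw [h]
  exact (map_sum (evalStable hz) _ _).trans
    (Finset.sum_congr rfl fun i _ => map_smul (evalStable hz) (c i) (g i))

/-- The point `e^{iφ}` of the unit circle, in the form in which the `H₂` norms use it. -/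
abbrev circlePoint (φ : ℝ) : ℂ := Complex.exp (Complex.I * φ)

theorem norm_circlePoint (φ : ℝ) : ‖circlePoint φ‖ = 1 := by
  rw [circlePoint, mul_comm, Complex.norm_exp_ofReal_mul_I]

theorem continuous_eval_circlePoint {g : RatFunc F} (hg : g ∈ stableSubalgebra F) :
    Continuous fun φ : ℝ => RatFunc.eval (algebraMap F ℂ) (circlePoint φ) g := by
  have continuous_eval₂ (p : Polynomial F) :
      Continuous fun φ : ℝ => p.eval₂ (algebraMap F ℂ) (circlePoint φ) := by
    simp only [Polynomial.eval₂_eq_eval_map]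
    fun_prop
  exact (continuous_eval₂ _).div (continuous_eval₂ _) fun φ =>
    eval₂_denom_ne_zero hg (norm_circlePoint φ).ge

end Evaluation

section Complexify

theorem denom_div_of_isCoprime {F : Type*} [Field F] {p q : Polynomial F} (h : IsCoprime p q)
    (hq : q.Monic) :
    (algebraMap _ (RatFunc F) p / algebraMap _ (RatFunc F) q).denom = q := by
  refine Polynomial.eq_of_monic_of_associated (RatFunc.monic_denom _) hq
    (associated_of_dvd_dvd (RatFunc.denom_div_dvd p q) (h.symm.dvd_of_dvd_mul_left ?_))
  rw [← (RatFunc.num_mul_eq_mul_denom_iff hq.ne_zero).2 rfl]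
  exact dvd_mul_left q _

theorem num_div_of_isCoprime {F : Type*} [Field F] {p q : Polynomial F} (h : IsCoprime p q)
    (hq : q.Monic) :
    (algebraMap _ (RatFunc F) p / algebraMap _ (RatFunc F) q).num = p := by
  have hnum := (RatFunc.num_mul_eq_mul_denom_iff (p := p) hq.ne_zero).2 rfl
  rw [denom_div_of_isCoprime h hq] at hnum
  exact mul_right_cancel₀ hq.ne_zero hnum

theorem complexify_eq_div (g : RatFunc ℝ) :
    complexify g = algebraMap _ (RatFunc ℂ) (g.num.map (algebraMap ℝ ℂ)) /
      algebraMap _ (RatFunc ℂ) (g.denom.map (algebraMap ℝ ℂ)) := by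
  rw [complexify, RatFunc.coe_mapRingHom_eq_coe_map, RatFunc.map_apply]
  rfl

theorem isCoprime_map_num_denom (g : RatFunc ℝ) :
    IsCoprime (g.num.map (algebraMap ℝ ℂ)) (g.denom.map (algebraMap ℝ ℂ)) :=
  g.isCoprime_num_denom.map (Polynomial.mapRingHom (algebraMap ℝ ℂ))

theorem num_complexify (g : RatFunc ℝ) :
    (complexify g).num = g.num.map (algebraMap ℝ ℂ) := by
  rw [complexify_eq_div,
    num_div_of_isCoprime (isCoprime_map_num_denom g) (g.monic_denom.map _)]

theorem denom_complexify (g : RatFunc ℝ) :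
    (complexify g).denom = g.denom.map (algebraMap ℝ ℂ) := by
  rw [complexify_eq_div,
    denom_div_of_isCoprime (isCoprime_map_num_denom g) (g.monic_denom.map _)]

theorem complexify_mem_stableSubalgebra {g : RatFunc ℝ} :
    complexify g ∈ stableSubalgebra ℂ ↔ g ∈ stableSubalgebra ℝ :=
  forall_congr' fun p => by rw [denom_complexify, Polynomial.aeval_map_algebraMap]

theorem complexify_mem_rhInf {g : RatFunc ℝ} : complexify g ∈ rhInf ℂ ↔ g ∈ rhInf ℝ :=
  and_congr (by simp only [SetLike.mem_coe, mem_properSubalgebra, RatFunc.intDegree,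
      num_complexify, denom_complexify, Polynomial.natDegree_map])
    complexify_mem_stableSubalgebra

theorem eval_complexify (g : RatFunc ℝ) (z : ℂ) :
    RatFunc.eval (algebraMap ℂ ℂ) z (complexify g) = RatFunc.eval (algebraMap ℝ ℂ) z g := by
  simp only [RatFunc.eval, num_complexify, denom_complexify, Polynomial.eval₂_map]
  rfl

@[simp]
theorem complexify_C (c : ℝ) : complexify (RatFunc.C c) = RatFunc.C (c : ℂ) := by
  rw [complexify_eq_div]
  simp

@[simp]
theorem complexify_X : complexify RatFunc.X = RatFunc.X := by
  rw [complexify_eq_div]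
  simp

end Complexify

section Symbols

open LaurentPolynomial

variable {R : Type*} [CommSemiring R]

/-- The Laurent polynomial `∑_{|k| ≤ E} g_k T^k`. Convolution of columns, i.e. the action of banded
Toeplitz matrices, becomes multiplication of symbols. -/
def symbol {E : ℕ} : (Site E → R) →ₗ[R] R[T;T⁻¹] := Fintype.linearCombination R fun k => T k

/-- The Laurent polynomials `∑_{|k| ≤ E} g_k T^k`, i.e. the symbols of extent `E`. -/
def band (R : Type*) [CommSemiring R] (E : ℕ) : Submodule R R[T;T⁻¹] :=
  Submodule.span R (T '' {k | |k| ≤ E})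

theorem symbol_apply {E : ℕ} (g : Site E → R) : symbol g = ∑ k, g k • T (k : ℤ) := rfl

theorem range_symbol (E : ℕ) : LinearMap.range (symbol (R := R) (E := E)) = band R E := by
  rw [symbol, Fintype.range_linearCombination, band]
  congr 1
  ext p
  simp [abs_le]

theorem symbol_mem_band {E : ℕ} (g : Site E → R) : symbol g ∈ band R E :=
  range_symbol (R := R) E ▸ LinearMap.mem_range_self symbol g

theorem coeff_symbol {E : ℕ} (g : Site E → R) (k : ℤ) :
    (symbol g).coeff k = if hk : k ∈ Finset.Icc (-(E : ℤ)) E then g ⟨k, hk⟩ else 0 := by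
  simp only [symbol_apply, AddMonoidAlgebra.coeff_sum, Finsupp.finsetSum_apply,
    AddMonoidAlgebra.coeff_smul, Finsupp.smul_apply, T_apply, smul_eq_mul, mul_ite, mul_one,
    mul_zero]
  split_ifs with hk
  · rw [Finset.sum_eq_single ⟨k, hk⟩] <;> simp +contextual [Subtype.ext_iff]
  · exact Finset.sum_eq_zero fun i _ => if_neg fun hi : (i : ℤ) = k => hk (hi ▸ i.2)

theorem coeff_eq_zero_of_mem_band {E : ℕ} {p : R[T;T⁻¹]} (hp : p ∈ band R E) {k : ℤ}
    (hk : E < |k|) : p.coeff k = 0 := by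
  rw [← range_symbol] at hp
  obtain ⟨g, rfl⟩ := hp
  rw [coeff_symbol, dif_neg]
  rwa [Finset.mem_Icc, ← abs_le, not_le]

theorem band_mono {m n : ℕ} (h : m ≤ n) : band R m ≤ band R n :=
  Submodule.span_mono <| Set.image_mono fun k (hk : |k| ≤ m) => hk.trans (mod_cast h)

theorem mul_mem_band {m n : ℕ} {p q : R[T;T⁻¹]} (hp : p ∈ band R m) (hq : q ∈ band R n) :
    p * q ∈ band R (m + n) := by
  have hpq := Submodule.mul_mem_mul hp hq
  rw [band, band, Submodule.span_mul_span] at hpq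
  refine Submodule.span_mono ?_ hpq
  rintro _ ⟨_, ⟨k, hk, rfl⟩, _, ⟨l, hl, rfl⟩, rfl⟩
  refine ⟨k + l, ?_, T_add k l⟩
  push_cast
  exact (abs_add_le k l).trans (add_le_add hk hl)

theorem T_mem_band {E : ℕ} {k : ℤ} (hk : |k| ≤ E) : T k ∈ band R E :=
  Submodule.subset_span ⟨k, hk, rfl⟩

theorem C_mem_band (a : R) (E : ℕ) : C a ∈ band R E := by
  rw [← mul_one (C a), ← T_zero, ← LaurentPolynomial.smul_eq_C_mul]
  exact Submodule.smul_mem _ _ (T_mem_band (by simp))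

/-- The Toeplitz matrix of multiplication by the symbol `p`, cut down to finitely many sites. -/
def toeplitz (p : R[T;T⁻¹]) (m n : ℕ) : Matrix (Site m) (Site n) R :=
  Matrix.of fun i j => p.coeff (i - j)

/-- The coefficients of the symbol `p` at the sites `|k| ≤ E`. -/
def column (E : ℕ) : R[T;T⁻¹] →ₗ[R] Site E → R where
  toFun p k := p.coeff k
  map_add' _ _ := rfl
  map_smul' _ _ := rfl

theorem column_apply {E : ℕ} (p : R[T;T⁻¹]) (k : Site E) : column E p k = p.coeff k := rfl

theorem symbol_column {E : ℕ} {p : R[T;T⁻¹]} (hp : p ∈ band R E) : symbol (column E p) = p := by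
  refine LaurentPolynomial.ext fun k => ?_
  rw [coeff_symbol]
  split_ifs with hk
  · rfl
  · rw [Finset.mem_Icc, ← abs_le, not_le] at hk
    exact (coeff_eq_zero_of_mem_band hp hk).symm

theorem toeplitz_mulVec (p : R[T;T⁻¹]) {m n : ℕ} (g : Site n → R) :
    (toeplitz p m n).mulVec g = column m (p * symbol g) := by
  ext i
  simp only [Matrix.mulVec, dotProduct, toeplitz, Matrix.of_apply, column_apply, symbol_apply,
    Finset.mul_sum, AddMonoidAlgebra.coeff_sum, Finsupp.finsetSum_apply, mul_smul_comm,
    AddMonoidAlgebra.coeff_smul, Finsupp.smul_apply, smul_eq_mul]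
  refine Finset.sum_congr rfl fun j _ => ?_
  rw [mul_comm, T, AddMonoidAlgebra.coeff_mul_single_eq_coeff_mul ((i : ℤ) - j)
    fun k _ => eq_sub_iff_add_eq.symm, mul_one]

theorem coeff_C_mul (a : R) (p : R[T;T⁻¹]) (k : ℤ) : (C a * p).coeff k = a * p.coeff k := by
  rw [← LaurentPolynomial.smul_eq_C_mul, AddMonoidAlgebra.coeff_smul, Finsupp.smul_apply,
    smul_eq_mul]

theorem coeff_pentadiagonal (a b c : R) (k : ℤ) :
    (C a + C b * (T 1 + T (-1)) + C c * (T 2 + T (-2))).coeff k =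
      if |k| = 0 then a else if |k| = 1 then b else if |k| = 2 then c else 0 := by
  simp only [AddMonoidAlgebra.coeff_add, Finsupp.add_apply, coeff_C_mul, C_apply, T_apply,
    abs_eq_zero, abs_eq (zero_le_one (α := ℤ)), abs_eq (zero_le_two (α := ℤ))]
  split_ifs <;> first | (exfalso; lia) | simp

theorem coeff_tridiagonal (a b : R) (k : ℤ) :
    (C a + C b * (T 1 + T (-1))).coeff k =
      if |k| = 0 then a else if |k| = 1 then b else 0 := by
  simpa using coeff_pentadiagonal a b 0 k

end Symbols

section Characters

/-- The character `e^{-ikθ}`, with the sign of the spatial transform. -/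
def character (k : ℤ) (θ : ℝ) : ℂ := Complex.exp (-(Complex.I * (k : ℂ) * (θ : ℂ)))

theorem continuous_character (k : ℤ) : Continuous (character k) := by
  unfold character
  fun_prop

section Parseval

variable {T : ℝ} [Fact (0 < T)] {ι : Type*} [Fintype ι] {n : ι → ℤ}

theorem norm_sq_sum_smul_fourierLp (hn : Function.Injective n) (a : ι → ℂ) :
    ‖∑ i, a i • fourierLp (T := T) 2 (n i)‖ ^ 2 = ∑ i, ‖a i‖ ^ 2 := by
  simpa using (orthonormal_fourier.comp n hn).orthogonalFamily.norm_sum a Finset.univ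

theorem lintegral_enorm_sq_sum_fourier (hn : Function.Injective n) (a : ι → ℂ) :
    ∫⁻ x : AddCircle T, ‖∑ i, a i * fourier (n i) x‖ₑ ^ 2 =
      ENNReal.ofReal T * ∑ i, ‖a i‖ₑ ^ 2 := by
  set f : C(AddCircle T, ℂ) := ∑ i, a i • fourier (n i)
  have hf : f.toLp 2 AddCircle.haarAddCircle ℂ = ∑ i, a i • fourierLp (T := T) 2 (n i) := by
    simp [f]
  have hnorm : ∫⁻ x, ‖f x‖ₑ ^ 2 ∂AddCircle.haarAddCircle =
      ‖f.toLp 2 AddCircle.haarAddCircle ℂ‖ₑ ^ 2 := by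
    rw [Lp.enorm_def, eLpNorm_congr_ae (ContinuousMap.coeFn_toLp _ f)]
    simpa using (eLpNorm_nnreal_pow_eq_lintegral (p := 2) two_ne_zero).symm
  have hsum : ‖∑ i, a i • fourierLp (T := T) 2 (n i)‖ₑ ^ 2 = ∑ i, ‖a i‖ₑ ^ 2 := by
    simp only [← ofReal_norm, ← ENNReal.ofReal_pow, norm_nonneg, norm_sq_sum_smul_fourierLp hn,
      ENNReal.ofReal_sum_of_nonneg, sq_nonneg, implies_true]
  rw [AddCircle.volume_eq_smul_haarAddCircle, lintegral_smul_measure, smul_eq_mul, ← hsum, ← hf,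
    ← hnorm]
  simp [f]

end Parseval

theorem lintegral_enorm_sq_sum_character {ι : Type*} [Fintype ι] {n : ι → ℤ}
    (hn : Function.Injective n) (a : ι → ℂ) :
    ∫⁻ θ in Set.Ico 0 (2 * Real.pi), ‖∑ i, character (n i) θ * a i‖ₑ ^ 2 =
      ENNReal.ofReal (2 * Real.pi) * ∑ i, ‖a i‖ₑ ^ 2 := by
  have : Fact (0 < 2 * Real.pi) := ⟨Real.two_pi_pos⟩
  rw [← lintegral_enorm_sq_sum_fourier (neg_injective.comp hn), ← AddCircle.lintegral_preimage _ 0,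
    zero_add, setLIntegral_congr Ico_ae_eq_Ioc]
  refine setLIntegral_congr_fun measurableSet_Ioc fun θ _ => ?_
  have hchar (k : ℤ) : fourier (T := 2 * Real.pi) (-k) θ = character k θ := by
    rw [fourier_coe_apply, character]
    congr 1
    push_cast
    field_simp
  simp only [Function.comp_apply, hchar, mul_comm]

/-- A linear functional vanishing on the submodule reduces this to Parseval's identity. -/
theorem mem_of_sum_character_smul_mem {M : Type*} [AddCommGroup M] [Module ℂ M]
    (N : Submodule ℂ M) {ι : Type*} [Fintype ι] {n : ι → ℤ} (hn : Function.Injective n)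
    (a : ι → M) (h : ∀ θ : Freq, ∑ i, character (n i) θ • a i ∈ N) (i : ι) : a i ∈ N := by
  by_contra hi
  obtain ⟨φ, hφ, hN⟩ := N.exists_le_ker_of_notMem hi
  have hsum : ∀ θ ∈ Set.Ico 0 (2 * Real.pi), ‖∑ j, character (n j) θ * φ (a j)‖ₑ ^ 2 = 0 :=
    fun θ hθ => by
      have h0 : φ (∑ j, character (n j) θ • a j) = 0 := hN (h ⟨θ, hθ⟩)
      simpa using h0
  have hparseval := lintegral_enorm_sq_sum_character hn fun j => φ (a j)
  rw [setLIntegral_congr_fun measurableSet_Ico hsum, lintegral_zero, eq_comm, mul_eq_zero,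
    ENNReal.ofReal_eq_zero, Finset.sum_eq_zero_iff] at hparseval
  have hi0 := hparseval.resolve_left Real.two_pi_pos.not_ge i (Finset.mem_univ i)
  exact hφ (by simpa using hi0)

end Characters

section SpatialTransform

open LaurentPolynomial

/-- The value at frequency `θ` of a symbol with real rational coefficients: `T` becomes
`e^{-iθ}`. -/
def symbolEval (θ : Freq) : (RatFunc ℝ)[T;T⁻¹] →+* RatFunc ℂ :=
  LaurentPolynomial.eval₂ complexify <| Units.map (RatFunc.C : ℂ →+* RatFunc ℂ).toMonoidHom <|
    Units.mk0 (Complex.exp (-(Complex.I * θ))) (Complex.exp_ne_zero _)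

@[simp]
theorem symbolEval_C (θ : Freq) (a : RatFunc ℝ) : symbolEval θ (C a) = complexify a :=
  LaurentPolynomial.eval₂_C ..

@[simp]
theorem symbolEval_T (θ : Freq) (k : ℤ) : symbolEval θ (T k) = RatFunc.C (character k θ) := by
  have hexp : Complex.exp (-(Complex.I * θ)) ^ k = character k θ := by
    rw [← Complex.exp_int_mul, character]
    ring_nf
  rw [symbolEval, LaurentPolynomial.eval₂_T, ← map_zpow, ← hexp]
  simp

theorem symbolEval_symbol {E : ℕ} (g : Site E → RatFunc ℝ) (θ : Freq) :
    symbolEval θ (symbol g) = spatialTransform g θ := by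
  simp only [symbol_apply, map_sum, LaurentPolynomial.smul_eq_C_mul, map_mul, symbolEval_C,
    symbolEval_T, mul_comm, spatialTransform, character]

theorem spatialTransform_column {E : ℕ} {p : (RatFunc ℝ)[T;T⁻¹]} (hp : p ∈ band (RatFunc ℝ) E)
    (θ : Freq) : spatialTransform (column E p) θ = symbolEval θ p := by
  rw [← symbolEval_symbol, symbol_column hp]

theorem spatialTransform_eq_sum_smul {E : ℕ} (g : Site E → RatFunc ℝ) (θ : Freq) :
    spatialTransform g θ = ∑ k : Site E, character k θ • complexify (g k) := by
  simp only [RatFunc.smul_eq_C_mul]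
  rfl

theorem complexify_mem_of_spatialTransform_mem (N : Submodule ℂ (RatFunc ℂ)) {E : ℕ}
    {g : Site E → RatFunc ℝ} (h : ∀ θ, spatialTransform g θ ∈ N) (k : Site E) :
    complexify (g k) ∈ N :=
  mem_of_sum_character_smul_mem N Subtype.val_injective (fun k => complexify (g k))
    (fun θ => spatialTransform_eq_sum_smul g θ ▸ h θ) k

theorem spatialTransform_injective (E : ℕ) :
    Function.Injective (spatialTransform : (Site E → RatFunc ℝ) → Freq → RatFunc ℂ) := by
  intro f g hfg
  have hsub : ∀ θ, spatialTransform (f - g) θ ∈ (⊥ : Submodule ℂ (RatFunc ℂ)) := fun θ => by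
    rw [Submodule.mem_bot, ← symbolEval_symbol, map_sub, map_sub, symbolEval_symbol,
      symbolEval_symbol, hfg, sub_self]
  ext1 k
  simpa [sub_eq_zero, complexify.injective.eq_iff] using
    complexify_mem_of_spatialTransform_mem ⊥ hsub k

theorem spatialTransform_mem_rhInf_iff {E : ℕ} {g : Site E → RatFunc ℝ} :
    (∀ θ, spatialTransform g θ ∈ rhInf ℂ) ↔ ∀ k, g k ∈ rhInf ℝ := by
  refine ⟨fun h k => complexify_mem_rhInf.1 ?_, fun h θ => ?_⟩
  · exact complexify_mem_of_spatialTransform_mem (rhInf ℂ).toSubmodule h k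
  · rw [spatialTransform_eq_sum_smul]
    exact sum_mem fun k _ => (rhInf ℂ).smul_mem (complexify_mem_rhInf.2 (h k)) _

theorem mem_stableSubalgebra_of_spatialTransform {E : ℕ} {g : Site E → RatFunc ℝ}
    (h : ∀ θ, spatialTransform g θ ∈ stableSubalgebra ℂ) (k : Site E) :
    g k ∈ stableSubalgebra ℝ :=
  complexify_mem_stableSubalgebra.1
    (complexify_mem_of_spatialTransform_mem (stableSubalgebra ℂ).toSubmodule h k)

theorem hasExtent_iff {G : Freq → RatFunc ℂ} {E : ℕ} :
    HasExtent G E ↔ ∃ p ∈ band (RatFunc ℝ) E, ∀ θ, G θ = symbolEval θ p := by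
  constructor
  · rintro ⟨g, hg⟩
    exact ⟨symbol g, symbol_mem_band g, fun θ => by rw [hg, symbolEval_symbol]⟩
  · rintro ⟨p, hp, hG⟩
    exact ⟨column E p, fun θ => by rw [hG, spatialTransform_column hp]⟩

theorem HasExtent.mono {G : Freq → RatFunc ℂ} {m n : ℕ} (h : HasExtent G m) (hmn : m ≤ n) :
    HasExtent G n := by
  obtain ⟨p, hp, hG⟩ := hasExtent_iff.1 h
  exact hasExtent_iff.2 ⟨p, band_mono hmn hp, hG⟩

end SpatialTransform

section PlantSymbols

open LaurentPolynomial

variable (α β κ : ℝ)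

/-- The symbol of `σ`, with `2 cos θ = e^{-iθ} + e^{iθ}`. -/
def sigmaSymbol : (RatFunc ℝ)[T;T⁻¹] :=
  C (RatFunc.C α) + C (RatFunc.C (α * κ)) * (T 1 + T (-1))

/-- The symbol of `(z - β)(z - σ)`. -/
def charSymbol : (RatFunc ℝ)[T;T⁻¹] := C (zSub β) * (C RatFunc.X - sigmaSymbol α κ)

theorem character_one_add_character_neg_one (θ : ℝ) :
    character 1 θ + character (-1) θ = 2 * (Real.cos θ : ℂ) := by
  rw [Complex.ofReal_cos, Complex.cos, character, character]
  push_cast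
  ring_nf

theorem symbolEval_sigmaSymbol (θ : Freq) :
    symbolEval θ (sigmaSymbol α κ) = RatFunc.C (sigma α κ θ : ℂ) := by
  rw [sigmaSymbol, map_add, map_mul, map_add, symbolEval_C, symbolEval_C, symbolEval_T,
    symbolEval_T, ← map_add RatFunc.C, character_one_add_character_neg_one, complexify_C,
    complexify_C, ← map_mul, ← map_add, sigma]
  push_cast
  ring_nf

theorem complexify_zSub (c : ℝ) : complexify (zSub c) = RatFunc.X - RatFunc.C (c : ℂ) := by
  rw [zSub, map_sub, complexify_X, complexify_C]

theorem symbolEval_charSymbol (θ : Freq) :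
    symbolEval θ (charSymbol α β κ) = charPoly α β κ θ := by
  rw [charSymbol, map_mul, map_sub, symbolEval_C, symbolEval_C, symbolEval_sigmaSymbol,
    complexify_zSub, complexify_X, charPoly]

theorem sigmaSymbol_mem_band : sigmaSymbol α κ ∈ band (RatFunc ℝ) 1 := by
  have hT : (T 1 + T (-1) : (RatFunc ℝ)[T;T⁻¹]) ∈ band (RatFunc ℝ) 1 :=
    add_mem (T_mem_band (by simp)) (T_mem_band (by simp))
  rw [sigmaSymbol, ← LaurentPolynomial.smul_eq_C_mul]
  exact add_mem (C_mem_band _ 1) (Submodule.smul_mem _ _ hT)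

theorem charSymbol_mem_band : charSymbol α β κ ∈ band (RatFunc ℝ) 1 := by
  rw [charSymbol, ← LaurentPolynomial.smul_eq_C_mul]
  exact Submodule.smul_mem _ _ (sub_mem (C_mem_band _ 1) (sigmaSymbol_mem_band α κ))

variable {E : ℕ} (f : Site E → RatFunc ℝ)

/-- The symbol of `λ(f)`. -/
def lamSymbol : (RatFunc ℝ)[T;T⁻¹] :=
  C (RatFunc.X ^ 2)⁻¹ + C (RatFunc.X ^ 3)⁻¹ * (sigmaSymbol α κ + C (RatFunc.C β)) +
    C (RatFunc.X ^ 4)⁻¹ * symbol f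

/-- The symbol of `γ(f) - 1`. -/
def gamSubOneSymbol : (RatFunc ℝ)[T;T⁻¹] := charSymbol α β κ * lamSymbol α β κ f - 1

/-- The symbol of `ψ(f)`. -/
def psiSymbol : (RatFunc ℝ)[T;T⁻¹] :=
  charSymbol α β κ ^ 2 * lamSymbol α β κ f - charSymbol α β κ

variable (θ : Freq)

theorem symbolEval_lamSymbol : symbolEval θ (lamSymbol α β κ f) = lamOf α β κ f θ := by
  simp only [lamSymbol, map_add, map_mul, symbolEval_C, symbolEval_sigmaSymbol,
    symbolEval_symbol, map_inv₀, map_pow, complexify_X, complexify_C, lamOf, Complex.ofReal_add]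

theorem symbolEval_gamSubOneSymbol :
    symbolEval θ (gamSubOneSymbol α β κ f) = gamOf α β κ f θ - 1 := by
  rw [gamSubOneSymbol, map_sub, map_mul, map_one, symbolEval_charSymbol, symbolEval_lamSymbol,
    gamOf]

theorem symbolEval_psiSymbol : symbolEval θ (psiSymbol α β κ f) = psiOf α β κ f θ := by
  rw [psiSymbol, map_sub, map_mul, map_pow, symbolEval_charSymbol, symbolEval_lamSymbol, psiOf]

theorem lamSymbol_mem_band : lamSymbol α β κ f ∈ band (RatFunc ℝ) (max E 1) := by
  simp only [lamSymbol, ← LaurentPolynomial.smul_eq_C_mul]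
  refine add_mem (add_mem (C_mem_band _ _) (Submodule.smul_mem _ _ ?_))
    (Submodule.smul_mem _ _ (band_mono (le_max_left E 1) (symbol_mem_band f)))
  exact band_mono (le_max_right E 1) (add_mem (sigmaSymbol_mem_band α κ) (C_mem_band _ 1))

theorem gamSubOneSymbol_mem_band :
    gamSubOneSymbol α β κ f ∈ band (RatFunc ℝ) (max (E + 1) 2) := by
  refine sub_mem (band_mono (by lia)
    (mul_mem_band (charSymbol_mem_band α β κ) (lamSymbol_mem_band α β κ f))) ?_
  simpa using C_mem_band (1 : RatFunc ℝ) (max (E + 1) 2)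

theorem psiSymbol_mem_band : psiSymbol α β κ f ∈ band (RatFunc ℝ) (max (E + 2) 3) := by
  have hc := charSymbol_mem_band α β κ
  rw [psiSymbol, sq]
  exact sub_mem (band_mono (by lia)
    (mul_mem_band (mul_mem_band hc hc) (lamSymbol_mem_band α β κ f))) (band_mono (by lia) hc)

end PlantSymbols

section StackedColumn

open LaurentPolynomial

variable (α β κ : ℝ)

theorem charSymbol_eq : charSymbol α β κ =
    C (zSub β) * (C (zSub α) + C (RatFunc.C (-(α * κ))) * (T 1 + T (-1))) := by
  simp only [charSymbol, sigmaSymbol, zSub, map_sub, map_neg]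
  ring

theorem charSymbol_sq_eq : charSymbol α β κ ^ 2 =
    C (zSub β ^ 2) * (C (zSub α ^ 2 + RatFunc.C (2 * (α * κ) ^ 2)) +
      C (RatFunc.C (-(2 * (α * κ))) * zSub α) * (T 1 + T (-1)) +
      C (RatFunc.C ((α * κ) ^ 2)) * (T 2 + T (-2))) := by
  have h2 : (T 2 : (RatFunc ℝ)[T;T⁻¹]) = T 1 ^ 2 := by rw [T_pow]; rfl
  have hneg2 : (T (-2) : (RatFunc ℝ)[T;T⁻¹]) = T (-1) ^ 2 := by rw [T_pow]; rfl
  have hone : (T 1 * T (-1) : (RatFunc ℝ)[T;T⁻¹]) = 1 := by rw [← T_add]; exact T_zero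
  rw [charSymbol_eq, h2, hneg2]
  simp only [map_neg, map_mul, map_pow, map_add, map_ofNat]
  linear_combination (2 * C (zSub β) ^ 2 * C (RatFunc.C α) ^ 2 * C (RatFunc.C κ) ^ 2) * hone

theorem matVGam_eq_toeplitz (E : ℕ) : matVGam α β κ E = toeplitz (charSymbol α β κ) _ _ := by
  ext i j
  rw [toeplitz, Matrix.of_apply, charSymbol_eq, coeff_C_mul, coeff_tridiagonal]
  rfl

theorem matVPsi_eq_toeplitz (E : ℕ) :
    matVPsi α β κ E = toeplitz (charSymbol α β κ ^ 2) _ _ := by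
  ext i j
  rw [toeplitz, Matrix.of_apply, charSymbol_sq_eq, coeff_C_mul, coeff_pentadiagonal]
  rfl

theorem matS_eq_toeplitz (E : ℕ) : matS E = toeplitz (C (RatFunc.X ^ 4)⁻¹) _ _ := by
  ext i j
  simp only [matS, toeplitz, Matrix.of_apply, C_apply, sub_eq_zero]

theorem vecHGam_eq_column (E : ℕ) : vecHGam E = column (E + 2) (-1) := by
  ext1 k
  rw [column_apply, ← map_one C, ← map_neg, C_apply, vecHGam]

theorem vecHPsi_eq_column (E : ℕ) :
    vecHPsi α β κ E = column (E + 3) (-charSymbol α β κ) := by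
  have hneg : -charSymbol α β κ =
      C (zSub β) * (C (-zSub α) + C (RatFunc.C (α * κ)) * (T 1 + T (-1))) := by
    simp only [charSymbol_eq, map_neg]
    ring
  ext1 k
  rw [column_apply, hneg, coeff_C_mul, coeff_tridiagonal]
  rfl

theorem vecG_eq_column (E : ℕ) : vecG α β κ E = column (E + 1)
    (C (RatFunc.X ^ 2)⁻¹ + C (RatFunc.X ^ 3)⁻¹ * (sigmaSymbol α κ + C (RatFunc.C β))) := by
  have hX : (RatFunc.X ^ 2 : RatFunc ℝ)⁻¹ = (RatFunc.X ^ 3)⁻¹ * RatFunc.X := by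
    field_simp [RatFunc.X_ne_zero]
  have hsymbol : C (RatFunc.X ^ 2)⁻¹ +
      C (RatFunc.X ^ 3)⁻¹ * (sigmaSymbol α κ + C (RatFunc.C β)) =
      C (RatFunc.X ^ 3)⁻¹ *
        (C (RatFunc.X + RatFunc.C (α + β)) + C (RatFunc.C (α * κ)) * (T 1 + T (-1))) := by
    rw [hX, sigmaSymbol]
    simp only [map_add, map_mul]
    ring
  ext1 k
  rw [column_apply, hsymbol, coeff_C_mul, coeff_tridiagonal]
  rfl

variable {E : ℕ} (f : Site E → RatFunc ℝ)

theorem matS_mulVec_add_vecG :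
    (matS E).mulVec f + vecG α β κ E = column (E + 1) (lamSymbol α β κ f) := by
  rw [matS_eq_toeplitz, toeplitz_mulVec, vecG_eq_column, ← map_add, lamSymbol,
    add_comm (C _ * symbol f)]

theorem symbol_column_lamSymbol :
    symbol (column (E + 1) (lamSymbol α β κ f)) = lamSymbol α β κ f :=
  symbol_column (band_mono (by lia) (lamSymbol_mem_band α β κ f))

theorem matVGam_mulVec_add_vecHGam :
    (matVGam α β κ E).mulVec (column (E + 1) (lamSymbol α β κ f)) + vecHGam E =
      column (E + 2) (gamSubOneSymbol α β κ f) := by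
  rw [matVGam_eq_toeplitz, toeplitz_mulVec, symbol_column_lamSymbol, vecHGam_eq_column,
    ← map_add, gamSubOneSymbol, sub_eq_add_neg]

theorem matVPsi_mulVec_add_vecHPsi :
    (matVPsi α β κ E).mulVec (column (E + 1) (lamSymbol α β κ f)) + vecHPsi α β κ E =
      column (E + 3) (psiSymbol α β κ f) := by
  rw [matVPsi_eq_toeplitz, toeplitz_mulVec, symbol_column_lamSymbol, vecHPsi_eq_column,
    ← map_add, psiSymbol, sub_eq_add_neg]

theorem matVIO_mulVec_add_vecHIO : (matVIO α β κ E).mulVec f + vecHIO α β κ E =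
    Sum.elim (column (E + 2) (gamSubOneSymbol α β κ f)) (
    Sum.elim (column (E + 1) (lamSymbol α β κ f)) (
    Sum.elim (column (E + 2) (zSub β • gamSubOneSymbol α β κ f)) (
    Sum.elim (column (E + 1) (zSub β • lamSymbol α β κ f)) (
    Sum.elim (column (E + 3) (psiSymbol α β κ f))
      (column (E + 2) (gamSubOneSymbol α β κ f)))))) := by
  have hstack : (matVIO α β κ E).mulVec f + vecHIO α β κ E =
      (matStack α β κ E).mulVec (column (E + 1) (lamSymbol α β κ f)) + vecStack α β κ E := by
    rw [← matS_mulVec_add_vecG, matVIO, vecHIO, Matrix.mulVec_add, ← Matrix.mulVec_mulVec,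
      add_assoc]
  rw [hstack, matStack, vecStack]
  simp only [Matrix.fromRows_mulVec, Matrix.one_mulVec, Matrix.smul_mulVec, ← Sum.elim_add_add,
    add_zero, ← smul_add, matVGam_mulVec_add_vecHGam, matVPsi_mulVec_add_vecHPsi, map_smul]

end StackedColumn

section Loop

variable (α β κ : ℝ) (θ : Freq)

theorem X_sub_C_ne_zero {F : Type*} [Field F] (a : F) : (RatFunc.X - RatFunc.C a) ≠ 0 := by
  rw [← RatFunc.algebraMap_X, ← RatFunc.algebraMap_C, ← map_sub]
  exact RatFunc.algebraMap_ne_zero (Polynomial.X_sub_C_ne_zero a)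

theorem charPoly_ne_zero : charPoly α β κ θ ≠ 0 :=
  mul_ne_zero (X_sub_C_ne_zero _) (X_sub_C_ne_zero _)

theorem inv_X_sub_C_sigma : (RatFunc.X - RatFunc.C (sigma α κ θ : ℂ))⁻¹ =
    (RatFunc.X - RatFunc.C (β : ℂ)) * (charPoly α β κ θ)⁻¹ := by
  rw [charPoly, mul_inv, mul_inv_cancel_left₀ (X_sub_C_ne_zero _)]

theorem plantResolvent_eq : plantResolvent α β κ θ =
    !![(RatFunc.X - RatFunc.C (β : ℂ))⁻¹, (charPoly α β κ θ)⁻¹;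
      0, (RatFunc.X - RatFunc.C (sigma α κ θ : ℂ))⁻¹] := by
  have hb := X_sub_C_ne_zero (β : ℂ)
  have hs := X_sub_C_ne_zero (sigma α κ θ : ℂ)
  have hcancel : (RatFunc.X - RatFunc.C (β : ℂ)) * (charPoly α β κ θ)⁻¹ +
      -(RatFunc.X - RatFunc.C (sigma α κ θ : ℂ))⁻¹ = 0 := by
    rw [← inv_X_sub_C_sigma, add_neg_cancel]
  refine Matrix.inv_eq_right_inv ?_
  ext i j
  fin_cases i <;> fin_cases j <;>
    simp [matA, Matrix.mul_apply, Fin.sum_univ_two, hb, hs, hcancel]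

theorem plantYU_eq : plantYU α β κ θ = (charPoly α β κ θ)⁻¹ := by
  simp [plantYU, plantResolvent_eq, matC2, matB2, Matrix.mul_apply, Fin.sum_univ_two]

theorem plantZW_eq : plantZW α β κ θ =
    !![0, (charPoly α β κ θ)⁻¹; 0, (RatFunc.X - RatFunc.C (sigma α κ θ : ℂ))⁻¹; 0, 0] := by
  ext i j
  fin_cases i <;> fin_cases j <;>
    simp [plantZW, plantResolvent_eq, matC1, matB1, Matrix.mul_apply, Fin.sum_univ_two]

theorem plantZU_eq : plantZU α β κ θ =
    !![(charPoly α β κ θ)⁻¹; (RatFunc.X - RatFunc.C (sigma α κ θ : ℂ))⁻¹; 1] := by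
  ext i j
  fin_cases i <;> fin_cases j <;>
    simp [plantZU, plantResolvent_eq, matC1, matB2, matD12, Matrix.mul_apply, Fin.sum_univ_two]

theorem plantYW_eq : plantYW α β κ θ = !![1, (charPoly α β κ θ)⁻¹] := by
  ext i j
  fin_cases i
  fin_cases j <;>
    simp [plantYW, plantResolvent_eq, matC2, matB1, matD21, Matrix.mul_apply, Fin.sum_univ_two]

variable (K : Controller)

theorem det_loopMatrix : (loopMatrix α β κ K θ).det = 1 - (charPoly α β κ θ)⁻¹ * K θ := by
  rw [loopMatrix, Matrix.det_fin_two_of, plantYU_eq]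
  ring

theorem ioMaps_eq : ioMaps α β κ K θ =
    (loopMatrix α β κ K θ).det⁻¹ • !![1, (charPoly α β κ θ)⁻¹; K θ, 1] := by
  rw [ioMaps, Matrix.inv_def, Ring.inverse_eq_inv', loopMatrix, Matrix.adjugate_fin_two_of,
    plantYU_eq, neg_neg, neg_neg]

theorem Gam_eq_inv_det : Gam α β κ K θ = (loopMatrix α β κ K θ).det⁻¹ := by
  simp [Gam, ioMaps_eq]

theorem Ome_eq_Gam : Ome α β κ K θ = Gam α β κ K θ := by
  simp [Ome, Gam, ioMaps_eq]

theorem Lam_eq_Gam_mul : Lam α β κ K θ = Gam α β κ K θ * (charPoly α β κ θ)⁻¹ := by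
  simp [Lam, Gam, ioMaps_eq]

theorem Psi_eq_Gam_mul : Psi α β κ K θ = Gam α β κ K θ * K θ := by
  simp [Psi, Gam, ioMaps_eq]

theorem Gam_eq_charPoly_mul : Gam α β κ K θ = charPoly α β κ θ * Lam α β κ K θ := by
  rw [Lam_eq_Gam_mul, mul_left_comm, mul_inv_cancel₀ (charPoly_ne_zero α β κ θ), mul_one]

variable {θ K}

theorem Gam_ne_zero (h : (loopMatrix α β κ K θ).det ≠ 0) : Gam α β κ K θ ≠ 0 := by
  rw [Gam_eq_inv_det]
  exact inv_ne_zero h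

theorem Gam_mul_eq_one (h : (loopMatrix α β κ K θ).det ≠ 0) :
    Gam α β κ K θ * (1 - (charPoly α β κ θ)⁻¹ * K θ) = 1 := by
  rw [← det_loopMatrix, Gam_eq_inv_det, inv_mul_cancel₀ h]

theorem Psi_eq_charPoly_mul (h : (loopMatrix α β κ K θ).det ≠ 0) :
    Psi α β κ K θ = charPoly α β κ θ ^ 2 * Lam α β κ K θ - charPoly α β κ θ := by
  rw [sq, mul_assoc, ← Gam_eq_charPoly_mul, Psi_eq_Gam_mul]
  linear_combination -charPoly α β κ θ * Gam_mul_eq_one α β κ h -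
    Gam α β κ K θ * K θ * mul_inv_cancel₀ (charPoly_ne_zero α β κ θ)

theorem controller_eq (h : (loopMatrix α β κ K θ).det ≠ 0) :
    K θ = Psi α β κ K θ * (Gam α β κ K θ)⁻¹ := by
  rw [Psi_eq_Gam_mul, mul_comm, inv_mul_cancel_left₀ (Gam_ne_zero α β κ h)]

theorem closedLoop_eq (h : (loopMatrix α β κ K θ).det ≠ 0) :
    closedLoop α β κ K θ =
      !![Gam α β κ K θ - 1, Lam α β κ K θ;
        (RatFunc.X - RatFunc.C (β : ℂ)) * (Gam α β κ K θ - 1),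
          (RatFunc.X - RatFunc.C (β : ℂ)) * Lam α β κ K θ;
        Psi α β κ K θ, Ome α β κ K θ - 1] := by
  have hgain : (1 - plantYU α β κ θ * K θ)⁻¹ = Gam α β κ K θ := by
    rw [plantYU_eq, ← det_loopMatrix, Gam_eq_inv_det]
  have hone := Gam_mul_eq_one α β κ h
  rw [closedLoop, hgain, plantZW_eq, plantZU_eq, plantYW_eq, inv_X_sub_C_sigma α β κ,
    Ome_eq_Gam, Lam_eq_Gam_mul, Psi_eq_Gam_mul]
  ext i j
  fin_cases i <;> fin_cases j <;>
    simp only [Matrix.cons_mul, Matrix.vecMul_cons, Matrix.head_cons, Matrix.smul_cons, smul_eq_mul,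
      mul_one, one_smul, zero_add, add_zero, Matrix.smul_empty, Matrix.tail_cons,
      Matrix.empty_vecMul, Matrix.empty_mul, Equiv.symm_apply_apply, Matrix.smul_of,
      Fin.zero_eta, Fin.mk_one, Fin.reduceFinMk, Matrix.add_apply, Matrix.of_apply,
      Matrix.cons_val, Matrix.cons_val', Matrix.cons_val_zero, Matrix.cons_val_one,
      Matrix.cons_val_fin_one]
  · linear_combination -hone
  · linear_combination -(charPoly α β κ θ)⁻¹ * hone
  · linear_combination -(RatFunc.X - RatFunc.C (β : ℂ)) * hone
  · linear_combination -(RatFunc.X - RatFunc.C (β : ℂ)) * (charPoly α β κ θ)⁻¹ * hone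
  · ring
  · linear_combination -hone

end Loop

section Stability

theorem X_div_X_sub_C_mem_properSubalgebra {F : Type*} [Field F] (a : F) :
    RatFunc.X / (RatFunc.X - RatFunc.C a) ∈ properSubalgebra F := by
  have hdegree : (RatFunc.X - RatFunc.C a).intDegree = 1 := by
    rw [← RatFunc.algebraMap_X, ← RatFunc.algebraMap_C, ← map_sub, RatFunc.intDegree_polynomial,
      Polynomial.natDegree_X_sub_C, Nat.cast_one]
  rw [mem_properSubalgebra, div_eq_mul_inv, RatFunc.intDegree_mul RatFunc.X_ne_zero
    (inv_ne_zero (X_sub_C_ne_zero a)), RatFunc.intDegree_inv, hdegree, RatFunc.intDegree_X,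
    add_neg_cancel]

variable (α β κ : ℝ) (θ : Freq)

/-- `(1 - β z⁻¹)(1 - σ z⁻¹)`, i.e. `(z - β)(z - σ)` rescaled to an element of `RH∞`. -/
def reverseCharPoly : RatFunc ℂ :=
  (1 - RatFunc.C (β : ℂ) * RatFunc.X⁻¹) * (1 - RatFunc.C (sigma α κ θ : ℂ) * RatFunc.X⁻¹)

theorem charPoly_eq_X_sq_mul :
    charPoly α β κ θ = RatFunc.X ^ 2 * reverseCharPoly α β κ θ := by
  have hX := RatFunc.X_ne_zero (K := ℂ)
  rw [charPoly, reverseCharPoly]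
  field_simp

theorem reverseCharPoly_ne_zero : reverseCharPoly α β κ θ ≠ 0 :=
  right_ne_zero_of_mul (charPoly_eq_X_sq_mul α β κ θ ▸ charPoly_ne_zero α β κ θ)

theorem reverseCharPoly_mem_rhInf : reverseCharPoly α β κ θ ∈ rhInf ℂ :=
  mul_mem (sub_mem (one_mem _) (mul_mem (C_mem_rhInf _) inv_X_mem_rhInf))
    (sub_mem (one_mem _) (mul_mem (C_mem_rhInf _) inv_X_mem_rhInf))

theorem inv_reverseCharPoly_mem_properSubalgebra :
    (reverseCharPoly α β κ θ)⁻¹ ∈ properSubalgebra ℂ := by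
  have hX := RatFunc.X_ne_zero (K := ℂ)
  have hinv : (reverseCharPoly α β κ θ)⁻¹ = RatFunc.X / (RatFunc.X - RatFunc.C (β : ℂ)) *
      (RatFunc.X / (RatFunc.X - RatFunc.C (sigma α κ θ : ℂ))) := by
    rw [div_mul_div_comm, ← charPoly, charPoly_eq_X_sq_mul]
    field_simp
  rw [hinv]
  exact mul_mem (X_div_X_sub_C_mem_properSubalgebra _) (X_div_X_sub_C_mem_properSubalgebra _)

/-- `z² ((z - β)(z - σ)(z⁻² + z⁻³ (σ + β)) - 1)`, an element of `RH∞` because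
`z⁻² + z⁻³ (σ + β)` is the expansion of `((z - β)(z - σ))⁻¹` at infinity up to `O(z⁻⁴)`. -/
def truncationDefect : RatFunc ℂ :=
  RatFunc.C ((sigma α κ θ * β : ℝ) : ℂ) - RatFunc.C ((sigma α κ θ + β : ℝ) : ℂ) ^ 2 +
    RatFunc.C ((sigma α κ θ * β : ℝ) : ℂ) * RatFunc.C ((sigma α κ θ + β : ℝ) : ℂ) * RatFunc.X⁻¹

theorem truncationDefect_mem_rhInf : truncationDefect α β κ θ ∈ rhInf ℂ :=
  add_mem (sub_mem (C_mem_rhInf _) (pow_mem (C_mem_rhInf _) 2))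
    (mul_mem (mul_mem (C_mem_rhInf _) (C_mem_rhInf _)) inv_X_mem_rhInf)

theorem charPoly_mul_sub_one (φ : RatFunc ℂ) :
    charPoly α β κ θ * ((RatFunc.X ^ 2)⁻¹ + (RatFunc.X ^ 3)⁻¹ *
      RatFunc.C ((sigma α κ θ + β : ℝ) : ℂ) + (RatFunc.X ^ 4)⁻¹ * φ) - 1 =
    RatFunc.X⁻¹ ^ 2 * (reverseCharPoly α β κ θ * φ + truncationDefect α β κ θ) := by
  have hX := RatFunc.X_ne_zero (K := ℂ)
  rw [charPoly, reverseCharPoly, truncationDefect]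
  push_cast
  rw [map_add, map_mul]
  field_simp
  ring

variable {α β κ θ} {K : Controller}

theorem Lam_eq_parameter : Lam α β κ K θ = (RatFunc.X ^ 2)⁻¹ + (RatFunc.X ^ 3)⁻¹ *
    RatFunc.C ((sigma α κ θ + β : ℝ) : ℂ) + (RatFunc.X ^ 4)⁻¹ * parameter α β κ K θ := by
  have hX := RatFunc.X_ne_zero (K := ℂ)
  rw [parameter]
  field_simp
  ring

theorem Psi_eq_parameter (h : (loopMatrix α β κ K θ).det ≠ 0) :
    Psi α β κ K θ = reverseCharPoly α β κ θ *
      (reverseCharPoly α β κ θ * parameter α β κ K θ + truncationDefect α β κ θ) := by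
  have hX := RatFunc.X_ne_zero (K := ℂ)
  have hsub := charPoly_mul_sub_one α β κ θ (parameter α β κ K θ)
  rw [← Lam_eq_parameter] at hsub
  rw [Psi_eq_charPoly_mul α β κ h, sq, mul_assoc, ← mul_sub_one, hsub, charPoly_eq_X_sq_mul]
  field_simp

/-- Properness of `Ψ` is what fixes the first two coefficients of `Λ` at infinity. -/
theorem parameter_mem_rhInf (h : (loopMatrix α β κ K θ).det ≠ 0)
    (hL : Lam α β κ K θ ∈ stableSubalgebra ℂ) (hP : Psi α β κ K θ ∈ properSubalgebra ℂ) :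
    parameter α β κ K θ ∈ rhInf ℂ := by
  have hX := X_mem_stableSubalgebra (F := ℂ)
  have hq := inv_reverseCharPoly_mem_properSubalgebra α β κ θ
  have hsolve : parameter α β κ K θ = (reverseCharPoly α β κ θ)⁻¹ *
      ((reverseCharPoly α β κ θ)⁻¹ * Psi α β κ K θ - truncationDefect α β κ θ) := by
    rw [Psi_eq_parameter h, inv_mul_cancel_left₀ (reverseCharPoly_ne_zero α β κ θ),
      add_sub_cancel_right, inv_mul_cancel_left₀ (reverseCharPoly_ne_zero α β κ θ)]
  refine ⟨?_, sub_mem (sub_mem (mul_mem (pow_mem hX 4) hL) (pow_mem hX 2))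
    (mul_mem hX (rhInf_le_stableSubalgebra (C_mem_rhInf _)))⟩
  exact hsolve ▸ mul_mem hq (sub_mem (mul_mem hq hP) (truncationDefect_mem_rhInf α β κ θ).1)

end Stability

section Parametrization

variable {α β κ : ℝ} {E : ℕ} {f : Site E → RatFunc ℝ}

theorem mem_RHInfVec : f ∈ RHInfVec E ↔ ∀ k, f k ∈ rhInf ℝ := by
  simp only [mem_rhInf]
  rfl

theorem spatialTransform_mem_rhInf (hf : f ∈ RHInfVec E) (θ : Freq) :
    spatialTransform f θ ∈ rhInf ℂ :=
  spatialTransform_mem_rhInf_iff.2 (mem_RHInfVec.1 hf) θ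

variable (α β κ)

/-- The tail of `γ(f) = 1 + z⁻² r` at infinity. -/
def gamTail (f : Site E → RatFunc ℝ) (θ : Freq) : RatFunc ℂ :=
  reverseCharPoly α β κ θ * spatialTransform f θ + truncationDefect α β κ θ

theorem gamTail_mem_rhInf (hf : f ∈ RHInfVec E) (θ : Freq) : gamTail α β κ f θ ∈ rhInf ℂ :=
  add_mem (mul_mem (reverseCharPoly_mem_rhInf α β κ θ) (spatialTransform_mem_rhInf hf θ))
    (truncationDefect_mem_rhInf α β κ θ)

theorem lamOf_mem_rhInf (hf : f ∈ RHInfVec E) (θ : Freq) : lamOf α β κ f θ ∈ rhInf ℂ := by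
  have hX := inv_X_mem_rhInf (F := ℂ)
  simp only [lamOf, ← inv_pow]
  exact add_mem (add_mem (pow_mem hX 2) (mul_mem (pow_mem hX 3) (C_mem_rhInf _)))
    (mul_mem (pow_mem hX 4) (spatialTransform_mem_rhInf hf θ))

theorem gamOf_sub_one (f : Site E → RatFunc ℝ) (θ : Freq) :
    gamOf α β κ f θ - 1 = RatFunc.X⁻¹ ^ 2 * gamTail α β κ f θ :=
  charPoly_mul_sub_one α β κ θ _

theorem psiOf_eq_charPoly_mul (f : Site E → RatFunc ℝ) (θ : Freq) :
    psiOf α β κ f θ = charPoly α β κ θ * (gamOf α β κ f θ - 1) := by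
  rw [psiOf, gamOf]
  ring

theorem gamOf_mem_rhInf (hf : f ∈ RHInfVec E) (θ : Freq) : gamOf α β κ f θ ∈ rhInf ℂ := by
  rw [← sub_add_cancel (gamOf α β κ f θ) 1, gamOf_sub_one]
  exact add_mem (mul_mem (pow_mem inv_X_mem_rhInf 2) (gamTail_mem_rhInf α β κ hf θ)) (one_mem _)

theorem psiOf_mem_rhInf (hf : f ∈ RHInfVec E) (θ : Freq) : psiOf α β κ f θ ∈ rhInf ℂ := by
  have hX := RatFunc.X_ne_zero (K := ℂ)
  have htail : psiOf α β κ f θ = reverseCharPoly α β κ θ * gamTail α β κ f θ := by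
    rw [psiOf_eq_charPoly_mul, gamOf_sub_one, charPoly_eq_X_sq_mul]
    field_simp
  exact htail ▸ mul_mem (reverseCharPoly_mem_rhInf α β κ θ) (gamTail_mem_rhInf α β κ hf θ)

theorem gamOf_ne_zero (hf : f ∈ RHInfVec E) (θ : Freq) : gamOf α β κ f θ ≠ 0 := by
  intro hzero
  have hX := RatFunc.X_ne_zero (K := ℂ)
  have hsub := gamOf_sub_one α β κ f θ
  have hX2 : RatFunc.X ^ 2 = -gamTail α β κ f θ := by
    rw [hzero] at hsub
    field_simp at hsub
    linear_combination -hsub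
  exact X_pow_notMem_properSubalgebra two_ne_zero
    (hX2 ▸ neg_mem (gamTail_mem_rhInf α β κ hf θ).1)

theorem det_loopMatrix_controllerOf (hf : f ∈ RHInfVec E) (θ : Freq) :
    (loopMatrix α β κ (controllerOf α β κ f) θ).det = (gamOf α β κ f θ)⁻¹ := by
  have hc := charPoly_ne_zero α β κ θ
  have hg := gamOf_ne_zero α β κ hf θ
  rw [det_loopMatrix, controllerOf, psiOf_eq_charPoly_mul]
  field_simp
  ring

theorem det_loopMatrix_controllerOf_ne_zero (hf : f ∈ RHInfVec E) (θ : Freq) :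
    (loopMatrix α β κ (controllerOf α β κ f) θ).det ≠ 0 := by
  rw [det_loopMatrix_controllerOf α β κ hf]
  exact inv_ne_zero (gamOf_ne_zero α β κ hf θ)

theorem Gam_controllerOf (hf : f ∈ RHInfVec E) (θ : Freq) :
    Gam α β κ (controllerOf α β κ f) θ = gamOf α β κ f θ := by
  rw [Gam_eq_inv_det, det_loopMatrix_controllerOf α β κ hf, inv_inv]

theorem Lam_controllerOf (hf : f ∈ RHInfVec E) (θ : Freq) :
    Lam α β κ (controllerOf α β κ f) θ = lamOf α β κ f θ := by
  refine mul_left_cancel₀ (charPoly_ne_zero α β κ θ) ?_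
  rw [← Gam_eq_charPoly_mul, Gam_controllerOf α β κ hf, gamOf]

theorem Ome_controllerOf (hf : f ∈ RHInfVec E) (θ : Freq) :
    Ome α β κ (controllerOf α β κ f) θ = gamOf α β κ f θ := by
  rw [Ome_eq_Gam, Gam_controllerOf α β κ hf]

theorem Psi_controllerOf (hf : f ∈ RHInfVec E) (θ : Freq) :
    Psi α β κ (controllerOf α β κ f) θ = psiOf α β κ f θ := by
  rw [Psi_eq_charPoly_mul α β κ (det_loopMatrix_controllerOf_ne_zero α β κ hf θ),
    Lam_controllerOf α β κ hf, psiOf]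

theorem internallyStabilizing_controllerOf (hf : f ∈ RHInfVec E) :
    InternallyStabilizing α β κ (controllerOf α β κ f) := fun θ => by
  rw [Gam_controllerOf α β κ hf, Lam_controllerOf α β κ hf, Psi_controllerOf α β κ hf,
    Ome_controllerOf α β κ hf, ← mem_rhInf, ← mem_rhInf, ← mem_rhInf]
  exact ⟨det_loopMatrix_controllerOf_ne_zero α β κ hf θ, gamOf_mem_rhInf α β κ hf θ,
    lamOf_mem_rhInf α β κ hf θ, psiOf_mem_rhInf α β κ hf θ, gamOf_mem_rhInf α β κ hf θ⟩

theorem parameter_controllerOf (hf : f ∈ RHInfVec E) (θ : Freq) :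
    parameter α β κ (controllerOf α β κ f) θ = spatialTransform f θ := by
  have hX := RatFunc.X_ne_zero (K := ℂ)
  rw [parameter, Lam_controllerOf α β κ hf, lamOf]
  field_simp
  ring

end Parametrization

section Feasibility

open LaurentPolynomial

variable {α β κ : ℝ} {E : ℕ}

theorem hasExtent_lamOf (f : Site E → RatFunc ℝ) : HasExtent (lamOf α β κ f) (max E 1) :=
  hasExtent_iff.2 ⟨_, lamSymbol_mem_band α β κ f, fun θ => (symbolEval_lamSymbol α β κ f θ).symm⟩

theorem hasExtent_gamOf (f : Site E → RatFunc ℝ) :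
    HasExtent (gamOf α β κ f) (max (E + 1) 2) := by
  refine hasExtent_iff.2 ⟨gamSubOneSymbol α β κ f + C 1,
    add_mem (gamSubOneSymbol_mem_band α β κ f) (C_mem_band 1 _), fun θ => ?_⟩
  rw [map_add, symbolEval_gamSubOneSymbol, map_one C, map_one, sub_add_cancel]

theorem hasExtent_psiOf (f : Site E → RatFunc ℝ) : HasExtent (psiOf α β κ f) (max (E + 2) 3) :=
  hasExtent_iff.2 ⟨_, psiSymbol_mem_band α β κ f, fun θ => (symbolEval_psiSymbol α β κ f θ).symm⟩

theorem hasExtent_parameter {K : Controller} (h : HasExtent (Lam α β κ K) E) :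
    HasExtent (parameter α β κ K) (max E 1) := by
  obtain ⟨p, hp, hK⟩ := hasExtent_iff.1 h
  have hs : sigmaSymbol α κ + C (RatFunc.C β) ∈ band (RatFunc ℝ) 1 :=
    add_mem (sigmaSymbol_mem_band α κ) (C_mem_band _ 1)
  refine hasExtent_iff.2 ⟨(RatFunc.X : RatFunc ℝ) ^ 4 • p - C (RatFunc.X ^ 2) -
    (RatFunc.X : RatFunc ℝ) • (sigmaSymbol α κ + C (RatFunc.C β)), ?_, fun θ => ?_⟩
  · exact sub_mem (sub_mem (Submodule.smul_mem _ _ (band_mono (le_max_left E 1) hp))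
      (C_mem_band _ _)) (Submodule.smul_mem _ _ (band_mono (le_max_right E 1) hs))
  · simp only [LaurentPolynomial.smul_eq_C_mul, map_sub, map_mul, map_add, map_pow, symbolEval_C,
      symbolEval_sigmaSymbol, complexify_X, complexify_C, parameter, hK, Complex.ofReal_add]

theorem controllerOf_mem_feasibleBounded {f : Site E → RatFunc ℝ} (hf : f ∈ RHInfVec E) :
    controllerOf α β κ f ∈ feasibleBounded α β κ E := by
  refine ⟨internallyStabilizing_controllerOf α β κ hf, ?_⟩
  rw [funext (Gam_controllerOf α β κ hf), funext (Lam_controllerOf α β κ hf),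
    funext (Psi_controllerOf α β κ hf), funext (Ome_controllerOf α β κ hf)]
  exact ⟨hasExtent_gamOf f, hasExtent_lamOf f, hasExtent_psiOf f, hasExtent_gamOf f⟩

theorem feasibleBounded_subset_feasible (E : ℕ) : feasibleBounded α β κ E ⊆ feasible α β κ :=
  fun _ ⟨hK, hGam, hLam, hPsi, hOme⟩ => ⟨hK, ⟨_, hGam⟩, ⟨_, hLam⟩, ⟨_, hPsi⟩, ⟨_, hOme⟩⟩

theorem exists_controllerOf_eq {K : Controller} (hK : InternallyStabilizing α β κ K)
    (hE : HasExtent (parameter α β κ K) E) : ∃ f ∈ RHInfVec E, controllerOf α β κ f = K := by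
  obtain ⟨f, hf⟩ := hE
  refine ⟨f, mem_RHInfVec.2 (spatialTransform_mem_rhInf_iff.1 fun θ => ?_), funext fun θ => ?_⟩
  · obtain ⟨hdet, -, hLam, hPsi, -⟩ := hK θ
    rw [← hf]
    exact parameter_mem_rhInf hdet (mem_rhInf.2 hLam).2 (mem_rhInf.2 hPsi).1
  · have hdet := (hK θ).1
    have hLam : lamOf α β κ f θ = Lam α β κ K θ := by rw [Lam_eq_parameter, hf, lamOf]
    rw [controller_eq α β κ hdet, Psi_eq_charPoly_mul α β κ hdet, Gam_eq_charPoly_mul, ← hLam]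
    rfl

theorem bijOn_controllerOf (E : ℕ) : Set.BijOn (controllerOf α β κ) (RHInfVec E)
    {K ∈ feasible α β κ | HasExtent (parameter α β κ K) E} := by
  refine ⟨fun f hf => ?_, fun f hf g hg hfg => ?_, fun K hK => exists_controllerOf_eq hK.1.1 hK.2⟩
  · exact ⟨feasibleBounded_subset_feasible E (controllerOf_mem_feasibleBounded hf),
      f, parameter_controllerOf α β κ hf⟩
  · refine spatialTransform_injective E (funext fun θ => ?_)
    rw [← parameter_controllerOf α β κ hf, ← parameter_controllerOf α β κ hg, hfg]

theorem setOf_parameter_eq_feasibleBounded (hE : 1 ≤ E) :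
    {K ∈ feasible α β κ | HasExtent (parameter α β κ K) E} = feasibleBounded α β κ E := by
  refine Set.Subset.antisymm (fun K ⟨hK, hparam⟩ => ?_) fun K hK => ?_
  · obtain ⟨f, hf, rfl⟩ := exists_controllerOf_eq hK.1 hparam
    exact controllerOf_mem_feasibleBounded hf
  · exact ⟨feasibleBounded_subset_feasible E hK, (hasExtent_parameter hK.2.2.1).mono (by lia)⟩

theorem feasible_eq_iUnion : feasible α β κ = ⋃ E : ℕ, controllerOf α β κ '' RHInfVec E := by
  refine Set.Subset.antisymm (fun K ⟨hK, _, ⟨E, hLam⟩, _⟩ => ?_) (Set.iUnion_subset fun E => ?_)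
  · exact Set.mem_iUnion.2 ⟨max E 1, exists_controllerOf_eq hK (hasExtent_parameter hLam)⟩
  · rintro _ ⟨f, hf, rfl⟩
    exact feasibleBounded_subset_feasible E (controllerOf_mem_feasibleBounded hf)

end Feasibility

section PowerSpectrum

theorem convex_setOf_mem_stableSubalgebra {m : Type*} :
    Convex ℝ {v : m → RatFunc ℝ | ∀ k, v k ∈ stableSubalgebra ℝ} :=
  fun _ hv _ hw a b _ _ _ k =>
    add_mem ((stableSubalgebra ℝ).smul_mem (hv k) a) ((stableSubalgebra ℝ).smul_mem (hw k) b)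

variable {m n : Type*} [Fintype m] [Fintype n] {v : m → RatFunc ℝ} {w : n → RatFunc ℝ}

/-- The power spectrum `∑ₖ |vₖ(e^{iφ})|²` of a column of transfer functions, the density of its
squared `H₂` norm. -/
def powerSpectrum (v : m → RatFunc ℝ) (φ : ℝ) : ℝ :=
  ∑ k, ‖RatFunc.eval (algebraMap ℝ ℂ) (circlePoint φ) (v k)‖ ^ 2

theorem powerSpectrum_nonneg (v : m → RatFunc ℝ) (φ : ℝ) : 0 ≤ powerSpectrum v φ :=
  Finset.sum_nonneg fun _ _ => sq_nonneg _

theorem ofReal_powerSpectrum (v : m → RatFunc ℝ) (φ : ℝ) : ENNReal.ofReal (powerSpectrum v φ) =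
    ∑ k, ‖RatFunc.eval (algebraMap ℝ ℂ) (circlePoint φ) (v k)‖ₑ ^ 2 := by
  rw [powerSpectrum, ENNReal.ofReal_sum_of_nonneg fun _ _ => sq_nonneg _]
  exact Finset.sum_congr rfl fun k _ => by rw [ENNReal.ofReal_pow (norm_nonneg _), ofReal_norm]

theorem h2NormSqIndex_eq_lintegral (v : m → RatFunc ℝ) : h2NormSqIndex v =
    ENNReal.ofReal (1 / (2 * Real.pi)) *
      ∫⁻ φ in Set.Ico 0 (2 * Real.pi), ENNReal.ofReal (powerSpectrum v φ) := by
  simp only [ofReal_powerSpectrum]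
  rfl

theorem continuous_powerSpectrum (hv : ∀ k, v k ∈ stableSubalgebra ℝ) :
    Continuous (powerSpectrum v) :=
  continuous_finsetSum _ fun k _ => (continuous_eval_circlePoint (hv k)).norm.pow 2

theorem measurable_ofReal_powerSpectrum (hv : ∀ k, v k ∈ stableSubalgebra ℝ) :
    Measurable fun φ => ENNReal.ofReal (powerSpectrum v φ) :=
  (continuous_powerSpectrum hv).measurable.ennreal_ofReal

theorem integrableOn_powerSpectrum (hv : ∀ k, v k ∈ stableSubalgebra ℝ) :
    IntegrableOn (powerSpectrum v) (Set.Ico 0 (2 * Real.pi)) :=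
  (continuous_powerSpectrum hv).integrableOn_Icc.mono_set Set.Ico_subset_Icc_self

theorem h2NormSqIndex_sumElim (hv : ∀ k, v k ∈ stableSubalgebra ℝ) :
    h2NormSqIndex (Sum.elim v w) = h2NormSqIndex v + h2NormSqIndex w := by
  have hadd (φ : ℝ) : ENNReal.ofReal (powerSpectrum (Sum.elim v w) φ) =
      ENNReal.ofReal (powerSpectrum v φ) + ENNReal.ofReal (powerSpectrum w φ) := by
    rw [← ENNReal.ofReal_add (powerSpectrum_nonneg v φ) (powerSpectrum_nonneg w φ),
      powerSpectrum, Fintype.sum_sum_type]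
    rfl
  simp only [h2NormSqIndex_eq_lintegral, hadd]
  rw [lintegral_add_left (measurable_ofReal_powerSpectrum hv), mul_add]

theorem h2NormSqIndex_eq_ofReal (hv : ∀ k, v k ∈ stableSubalgebra ℝ) : h2NormSqIndex v =
    ENNReal.ofReal (1 / (2 * Real.pi) * ∫ φ in Set.Ico 0 (2 * Real.pi), powerSpectrum v φ) := by
  rw [h2NormSqIndex_eq_lintegral, ENNReal.ofReal_mul (by positivity),
    ofReal_integral_eq_lintegral_ofReal (integrableOn_powerSpectrum hv)
      (Filter.Eventually.of_forall (powerSpectrum_nonneg v))]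

theorem h2NormSqIndex_ne_top (hv : ∀ k, v k ∈ stableSubalgebra ℝ) : h2NormSqIndex v ≠ ⊤ := by
  rw [h2NormSqIndex_eq_ofReal hv]
  exact ENNReal.ofReal_ne_top

theorem toReal_h2NormSqIndex (hv : ∀ k, v k ∈ stableSubalgebra ℝ) : (h2NormSqIndex v).toReal =
    1 / (2 * Real.pi) * ∫ φ in Set.Ico 0 (2 * Real.pi), powerSpectrum v φ := by
  rw [h2NormSqIndex_eq_ofReal hv, ENNReal.toReal_ofReal]
  exact mul_nonneg (by positivity) (integral_nonneg (powerSpectrum_nonneg v))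

theorem convexOn_powerSpectrum (φ : ℝ) :
    ConvexOn ℝ {v : m → RatFunc ℝ | ∀ k, v k ∈ stableSubalgebra ℝ}
      fun v => powerSpectrum v φ := by
  refine ⟨convex_setOf_mem_stableSubalgebra, fun v hv w hw a b ha hb hab => ?_⟩
  have heval (k : m) : RatFunc.eval (algebraMap ℝ ℂ) (circlePoint φ) ((a • v + b • w) k) =
      a • RatFunc.eval (algebraMap ℝ ℂ) (circlePoint φ) (v k) +
        b • RatFunc.eval (algebraMap ℝ ℂ) (circlePoint φ) (w k) := by
    simpa using eval_sum_smul ![a, b] (g := ![v k, w k])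
      (by simpa [Fin.forall_fin_two] using ⟨hv k, hw k⟩) (norm_circlePoint φ).ge
  have hconvex : ConvexOn ℝ Set.univ fun x : ℂ => ‖x‖ ^ 2 :=
    (convexOn_norm convex_univ).pow (fun _ _ => norm_nonneg _) 2
  simp only [powerSpectrum, heval, Finset.smul_sum, ← Finset.sum_add_distrib]
  exact Finset.sum_le_sum fun k _ => hconvex.2 (Set.mem_univ _) (Set.mem_univ _) ha hb hab

theorem convexOn_toReal_h2NormSqIndex :
    ConvexOn ℝ {v : m → RatFunc ℝ | ∀ k, v k ∈ stableSubalgebra ℝ}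
      fun v => (h2NormSqIndex v).toReal := by
  refine ⟨convex_setOf_mem_stableSubalgebra, fun v hv w hw a b ha hb hab => ?_⟩
  have hvw := convex_setOf_mem_stableSubalgebra hv hw ha hb hab
  have hiv := (integrableOn_powerSpectrum hv).const_mul a
  have hiw := (integrableOn_powerSpectrum hw).const_mul b
  simp only [toReal_h2NormSqIndex hvw, toReal_h2NormSqIndex hv, toReal_h2NormSqIndex hw,
    smul_eq_mul, mul_left_comm a, mul_left_comm b, ← mul_add, ← integral_const_mul a,
    ← integral_const_mul b, ← integral_add hiv hiw]
  refine mul_le_mul_of_nonneg_left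
    (integral_mono (integrableOn_powerSpectrum hvw) (hiv.add hiw) fun φ => ?_) (by positivity)
  exact (convexOn_powerSpectrum φ).2 hv hw ha hb hab

end PowerSpectrum

section NormEquality

theorem eval_spatialTransform {E : ℕ} {g : Site E → RatFunc ℝ}
    (hg : ∀ k, g k ∈ stableSubalgebra ℝ) (θ : Freq) {z : ℂ} (hz : 1 ≤ ‖z‖) :
    RatFunc.eval (RingHom.id ℂ) z (spatialTransform g θ) =
      ∑ k : Site E, character k θ * RatFunc.eval (algebraMap ℝ ℂ) z (g k) := by
  rw [spatialTransform_eq_sum_smul, ← Algebra.algebraMap_self, eval_sum_smul _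
    (fun k => complexify_mem_stableSubalgebra.2 (hg k)) hz]
  simp only [eval_complexify, smul_eq_mul]

theorem lintegral_lintegral_enorm_sq_spatialTransform {ι : Type*} [Fintype ι] {E : ι → ℕ}
    {g : ∀ i, Site (E i) → RatFunc ℝ} (hg : ∀ i k, g i k ∈ stableSubalgebra ℝ) :
    ∫⁻ θ : Freq, (∫⁻ φ in Set.Ico (0 : ℝ) (2 * Real.pi), ∑ i,
      ‖RatFunc.eval (RingHom.id ℂ) (circlePoint φ) (spatialTransform (g i) θ)‖ₑ ^ 2)
      ∂(Measure.comap Subtype.val volume) =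
    ENNReal.ofReal (2 * Real.pi) * ∫⁻ φ in Set.Ico (0 : ℝ) (2 * Real.pi), ∑ i,
      ENNReal.ofReal (powerSpectrum (g i) φ) := by
  let G (i : ι) (θ φ : ℝ) : ℂ := ∑ k : Site (E i),
    character k θ * RatFunc.eval (algebraMap ℝ ℂ) (circlePoint φ) (g i k)
  have hcont (i : ι) : Continuous (G i).uncurry := continuous_finsetSum _ fun k _ =>
    ((continuous_character _).comp continuous_fst).mul
      ((continuous_eval_circlePoint (hg i k)).comp continuous_snd)
  have hmeas (i : ι) : Measurable fun p : ℝ × ℝ => ‖G i p.1 p.2‖ₑ ^ 2 :=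
    (hcont i).measurable.enorm.pow_const 2
  have hparseval (φ : ℝ) : ∫⁻ θ in Set.Ico 0 (2 * Real.pi), ∑ i, ‖G i θ φ‖ₑ ^ 2 =
      ENNReal.ofReal (2 * Real.pi) * ∑ i, ENNReal.ofReal (powerSpectrum (g i) φ) := by
    have hslice (i : ι) : Measurable fun θ => ‖G i θ φ‖ₑ ^ 2 :=
      ((hcont i).uncurry_right φ).measurable.enorm.pow_const 2
    rw [lintegral_finsetSum _ fun i _ => hslice i, Finset.mul_sum]
    refine Finset.sum_congr rfl fun i _ => ?_
    rw [ofReal_powerSpectrum]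
    exact lintegral_enorm_sq_sum_character Subtype.val_injective _
  have heval (θ : Freq) (φ : ℝ) (i : ι) :
      RatFunc.eval (RingHom.id ℂ) (circlePoint φ) (spatialTransform (g i) θ) = G i θ φ :=
    eval_spatialTransform (hg i) θ (norm_circlePoint φ).ge
  simp only [heval]
  rw [lintegral_subtype_comap measurableSet_Ico
      fun θ => ∫⁻ φ in Set.Ico 0 (2 * Real.pi), ∑ i, ‖G i θ φ‖ₑ ^ 2,
    lintegral_lintegral_swap (Finset.measurable_sum _ fun i _ => hmeas i).aemeasurable]
  simp only [hparseval]
  rw [lintegral_const_mul' _ _ ENNReal.ofReal_ne_top]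

theorem h2NormSqFreq_spatialTransform {m n : Type*} [Fintype m] [Fintype n] {E : m → n → ℕ}
    {g : ∀ i j, Site (E i j) → RatFunc ℝ} (hg : ∀ i j k, g i j k ∈ stableSubalgebra ℝ) :
    h2NormSqFreq (fun θ => Matrix.of fun i j => spatialTransform (g i j) θ) =
      ∑ i, ∑ j, h2NormSqIndex (g i j) := by
  have hconst : ENNReal.ofReal (1 / (4 * Real.pi ^ 2)) * ENNReal.ofReal (2 * Real.pi) =
      ENNReal.ofReal (1 / (2 * Real.pi)) := by
    rw [← ENNReal.ofReal_mul (by positivity)]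
    congr 1
    field_simp
    norm_num
  simp only [h2NormSqFreq, Matrix.of_apply, h2NormSqIndex_eq_lintegral, ← Finset.mul_sum,
    ← Fintype.sum_prod_type']
  rw [lintegral_lintegral_enorm_sq_spatialTransform fun p : m × n => hg p.1 p.2, ← mul_assoc,
    hconst, lintegral_finsetSum _ fun p _ => measurable_ofReal_powerSpectrum (hg p.1 p.2)]

end NormEquality

section Objective

open LaurentPolynomial

variable (α β κ : ℝ) {E : ℕ} {f : Site E → RatFunc ℝ}

/-- The symbol of the closed-loop map from `w` to `ζ` under the controller `K(f)`. -/
def closedLoopSymbol (f : Site E → RatFunc ℝ) : Matrix (Fin 3) (Fin 2) (RatFunc ℝ)[T;T⁻¹] :=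
  !![gamSubOneSymbol α β κ f, lamSymbol α β κ f;
    zSub β • gamSubOneSymbol α β κ f, zSub β • lamSymbol α β κ f;
    psiSymbol α β κ f, gamSubOneSymbol α β κ f]

/-- The extents at which `V^{IO} f + h^{IO}` stacks the entries of the closed-loop map. -/
def closedLoopExtent (E : ℕ) : Matrix (Fin 3) (Fin 2) ℕ :=
  !![E + 2, E + 1; E + 2, E + 1; E + 3, E + 2]

theorem closedLoopSymbol_mem_band (f : Site E → RatFunc ℝ) (i : Fin 3) (j : Fin 2) :
    closedLoopSymbol α β κ f i j ∈ band (RatFunc ℝ) (closedLoopExtent E i j) := by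
  have hgam := band_mono (show max (E + 1) 2 ≤ E + 2 by lia) (gamSubOneSymbol_mem_band α β κ f)
  have hlam := band_mono (show max E 1 ≤ E + 1 by lia) (lamSymbol_mem_band α β κ f)
  have hpsi := band_mono (show max (E + 2) 3 ≤ E + 3 by lia) (psiSymbol_mem_band α β κ f)
  fin_cases i <;> fin_cases j
  exacts [hgam, hlam, Submodule.smul_mem _ _ hgam, Submodule.smul_mem _ _ hlam, hpsi, hgam]

theorem closedLoop_controllerOf (hf : f ∈ RHInfVec E) (θ : Freq) :
    closedLoop α β κ (controllerOf α β κ f) θ =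
      (closedLoopSymbol α β κ f).map (symbolEval θ) := by
  rw [closedLoop_eq α β κ (det_loopMatrix_controllerOf_ne_zero α β κ hf θ),
    Gam_controllerOf α β κ hf, Lam_controllerOf α β κ hf, Psi_controllerOf α β κ hf,
    Ome_controllerOf α β κ hf]
  ext i j
  fin_cases i <;> fin_cases j <;>
    simp [closedLoopSymbol, LaurentPolynomial.smul_eq_C_mul, symbolEval_gamSubOneSymbol,
      symbolEval_lamSymbol, symbolEval_psiSymbol, complexify_zSub]

theorem closedLoop_controllerOf_mem_stableSubalgebra (hf : f ∈ RHInfVec E) (θ : Freq) (i : Fin 3)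
    (j : Fin 2) : closedLoop α β κ (controllerOf α β κ f) θ i j ∈ stableSubalgebra ℂ := by
  have hz : RatFunc.X - RatFunc.C (β : ℂ) ∈ stableSubalgebra ℂ :=
    sub_mem X_mem_stableSubalgebra (rhInf_le_stableSubalgebra (C_mem_rhInf _))
  have hgam := sub_mem (rhInf_le_stableSubalgebra (gamOf_mem_rhInf α β κ hf θ)) (one_mem _)
  have hlam := rhInf_le_stableSubalgebra (lamOf_mem_rhInf α β κ hf θ)
  have hpsi := rhInf_le_stableSubalgebra (psiOf_mem_rhInf α β κ hf θ)
  rw [closedLoop_eq α β κ (det_loopMatrix_controllerOf_ne_zero α β κ hf θ),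
    Gam_controllerOf α β κ hf, Lam_controllerOf α β κ hf, Psi_controllerOf α β κ hf,
    Ome_controllerOf α β κ hf]
  fin_cases i <;> fin_cases j
  exacts [hgam, hlam, mul_mem hz hgam, mul_mem hz hlam, hpsi, hgam]

/-- The index-domain coefficients of the entries of the closed-loop map under `K(f)`, i.e. the
blocks of `V^{IO} f + h^{IO}`. -/
def closedLoopColumn (f : Site E → RatFunc ℝ) (i : Fin 3) (j : Fin 2) :
    Site (closedLoopExtent E i j) → RatFunc ℝ :=
  column _ (closedLoopSymbol α β κ f i j)

theorem spatialTransform_closedLoopColumn (hf : f ∈ RHInfVec E) (i : Fin 3) (j : Fin 2)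
    (θ : Freq) : spatialTransform (closedLoopColumn α β κ f i j) θ =
      closedLoop α β κ (controllerOf α β κ f) θ i j := by
  rw [closedLoopColumn, spatialTransform_column (closedLoopSymbol_mem_band α β κ f i j),
    closedLoop_controllerOf α β κ hf, Matrix.map_apply]

theorem closedLoopColumn_mem_stableSubalgebra (hf : f ∈ RHInfVec E) (i : Fin 3) (j : Fin 2)
    (k : Site (closedLoopExtent E i j)) :
    closedLoopColumn α β κ f i j k ∈ stableSubalgebra ℝ :=
  mem_stableSubalgebra_of_spatialTransform (fun θ =>
    spatialTransform_closedLoopColumn α β κ hf i j θ ▸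
      closedLoop_controllerOf_mem_stableSubalgebra α β κ hf θ i j) k

theorem matVIO_mulVec_add_vecHIO_mem_stableSubalgebra (hf : f ∈ RHInfVec E) (k : Rows E) :
    ((matVIO α β κ E).mulVec f + vecHIO α β κ E) k ∈ stableSubalgebra ℝ := by
  have hcolumn := closedLoopColumn_mem_stableSubalgebra α β κ hf
  rw [matVIO_mulVec_add_vecHIO]
  rcases k with k | k | k | k | k | k
  exacts [hcolumn 0 0 k, hcolumn 0 1 k, hcolumn 1 0 k, hcolumn 1 1 k, hcolumn 2 0 k, hcolumn 2 1 k]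

theorem objective_eq_sum (hf : f ∈ RHInfVec E) :
    objective α β κ E f = ∑ i, ∑ j, h2NormSqIndex (closedLoopColumn α β κ f i j) := by
  have hcolumn := closedLoopColumn_mem_stableSubalgebra α β κ hf
  rw [objective, matVIO_mulVec_add_vecHIO, h2NormSqIndex_sumElim, h2NormSqIndex_sumElim,
    h2NormSqIndex_sumElim, h2NormSqIndex_sumElim, h2NormSqIndex_sumElim]
  · simp only [Fin.sum_univ_three, Fin.sum_univ_two, add_assoc]
    rfl
  exacts [hcolumn 2 0, hcolumn 1 1, hcolumn 1 0, hcolumn 0 1, hcolumn 0 0]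

variable {α β κ}

theorem objective_ne_top (hf : f ∈ RHInfVec E) : objective α β κ E f ≠ ⊤ :=
  h2NormSqIndex_ne_top (matVIO_mulVec_add_vecHIO_mem_stableSubalgebra α β κ hf)

theorem h2NormSqFreq_controllerOf (hf : f ∈ RHInfVec E) :
    h2NormSqFreq (closedLoop α β κ (controllerOf α β κ f)) = objective α β κ E f := by
  rw [objective_eq_sum α β κ hf,
    ← h2NormSqFreq_spatialTransform (closedLoopColumn_mem_stableSubalgebra α β κ hf)]
  simp only [spatialTransform_closedLoopColumn α β κ hf]
  rfl

theorem cost_controllerOf_sq (hf : f ∈ RHInfVec E) :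
    cost α β κ (controllerOf α β κ f) ^ 2 = objective α β κ E f := by
  rw [cost, h2NormSqFreq_controllerOf hf, ← ENNReal.rpow_natCast, ← ENNReal.rpow_mul]
  norm_num

theorem convex_RHInfVec (E : ℕ) : Convex ℝ (RHInfVec E) := fun f hf g hg a b _ _ _ => by
  rw [mem_RHInfVec] at hf hg ⊢
  exact fun k => add_mem ((rhInf ℝ).smul_mem (hf k) a) ((rhInf ℝ).smul_mem (hg k) b)

theorem convexOn_objective (α β κ : ℝ) (E : ℕ) :
    ConvexOn ℝ (RHInfVec E) fun f => (objective α β κ E f).toReal := by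
  let A : (Site E → RatFunc ℝ) →ᵃ[ℝ] (Rows E → RatFunc ℝ) :=
    ((matVIO α β κ E).mulVecLin.restrictScalars ℝ).toAffineMap +
      AffineMap.const ℝ _ (vecHIO α β κ E)
  exact (convexOn_toReal_h2NormSqIndex.comp_affineMap A).subset
    (fun f hf => matVIO_mulVec_add_vecHIO_mem_stableSubalgebra α β κ hf) (convex_RHInfVec E)

end Objective

section Infima

variable {α β κ : ℝ} {E : ℕ}

theorem iInf_cost_sq (s : Set Controller) :
    (⨅ K ∈ s, cost α β κ K) ^ 2 = ⨅ K ∈ s, cost α β κ K ^ 2 := by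
  have hsq (x : ENNReal) : x ^ 2 = ENNReal.orderIsoRpow 2 two_pos x := by simp
  simp only [hsq, OrderIso.map_iInf]

theorem iInf_image_controllerOf (E : ℕ) :
    ⨅ K ∈ controllerOf α β κ '' RHInfVec E, cost α β κ K ^ 2 =
      ⨅ f ∈ RHInfVec E, objective α β κ E f := by
  rw [iInf_image]
  exact iInf_congr fun f => iInf_congr fun hf => cost_controllerOf_sq hf

theorem isMinOn_cost_iff {f : Site E → RatFunc ℝ} (hf : f ∈ RHInfVec E) :
    IsMinOn (cost α β κ) {K ∈ feasible α β κ | HasExtent (parameter α β κ K) E}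
      (controllerOf α β κ f) ↔ IsMinOn (objective α β κ E) (RHInfVec E) f := by
  rw [← (bijOn_controllerOf E).image_eq, isMinOn_iff, isMinOn_iff, Set.forall_mem_image]
  refine forall₂_congr fun g hg => ?_
  rw [← cost_controllerOf_sq hf, ← cost_controllerOf_sq hg,
    ENNReal.pow_le_pow_left_iff two_ne_zero]

end Infima

end

end IOSynthesis

open IOSynthesis in
theorem mainTheorem2 (α β κ : ℝ) :
    -- the map from `(wʸ, wᵘ)` to `(x¹, x², u)` in terms of the closed-loop maps
    (∀ K, InternallyStabilizing α β κ K → ∀ θ,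
      closedLoop α β κ K θ =
        !![Gam α β κ K θ - 1, Lam α β κ K θ;
          (RatFunc.X - RatFunc.C (β : ℂ)) * (Gam α β κ K θ - 1),
            (RatFunc.X - RatFunc.C (β : ℂ)) * Lam α β κ K θ;
          Psi α β κ K θ, Ome α β κ K θ - 1]) ∧
    -- the problem with prescribed parameter extent `E`
    (∀ E : ℕ,
      Fintype.card (Site E) = 2 * E + 1 ∧
      Set.BijOn (controllerOf α β κ) (RHInfVec E)
        {K ∈ feasible α β κ | HasExtent (parameter α β κ K) E} ∧
      (∀ f ∈ RHInfVec E,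
        controllerOf α β κ f ∈ feasibleBounded α β κ E ∧
        Lam α β κ (controllerOf α β κ f) = lamOf α β κ f ∧
        objective α β κ E f ≠ ⊤ ∧
        cost α β κ (controllerOf α β κ f) ^ 2 = objective α β κ E f) ∧
      (1 ≤ E → {K ∈ feasible α β κ | HasExtent (parameter α β κ K) E} =
        feasibleBounded α β κ E) ∧
      (⨅ K ∈ {K ∈ feasible α β κ | HasExtent (parameter α β κ K) E}, cost α β κ K) ^ 2 =
        (⨅ f ∈ RHInfVec E, objective α β κ E f) ∧
      (∀ f ∈ RHInfVec E,
        IsMinOn (cost α β κ) {K ∈ feasible α β κ | HasExtent (parameter α β κ K) E}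
          (controllerOf α β κ f) ↔ IsMinOn (objective α β κ E) (RHInfVec E) f) ∧
      ConvexOn ℝ (RHInfVec E) fun f => (objective α β κ E f).toReal) ∧
    -- the problem with finite, not prescribed, extent
    feasible α β κ = (⋃ E : ℕ, controllerOf α β κ '' RHInfVec E) ∧
    (⨅ K ∈ feasible α β κ, cost α β κ K) ^ 2 =
      ⨅ E : ℕ, ⨅ f ∈ RHInfVec E, objective α β κ E f := by
  refine ⟨fun K hK θ => closedLoop_eq α β κ (hK θ).1, fun E => ⟨?_, bijOn_controllerOf E,
    fun f hf => ⟨controllerOf_mem_feasibleBounded hf, funext (Lam_controllerOf α β κ hf),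
      objective_ne_top hf, cost_controllerOf_sq hf⟩, setOf_parameter_eq_feasibleBounded, ?_,
    fun f hf => isMinOn_cost_iff hf, convexOn_objective α β κ E⟩, feasible_eq_iUnion, ?_⟩
  · rw [Fintype.card_coe, Int.card_Icc]
    lia
  · rw [iInf_cost_sq, ← (bijOn_controllerOf E).image_eq, iInf_image_controllerOf]
  · rw [iInf_cost_sq, feasible_eq_iUnion, iInf_iUnion]
    exact iInf_congr iInf_image_controllerOf
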